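/- Graphs and digraphs are finite and may have loops and multiple edges; the degree of a vertex of a digraph is its total degree (indegree plus outdegree). A graph (digraph) is eulerian if it has a single circuit (directed circuit) containing all its edges (arcs) and all its vertices; such a circuit is called an euler circuit (directed euler circuit). A circuit interlaces two vertices $x$ and $y$ if it can be written cyclically as $(\dots x\dots y\dots x\dots y\dots)$. An edge cut separating $s$ and $t$ is the set of all edges (arcs, regardless of direction) between $U$ and its complement, for some vertex set $U$ with $s\in U$, $t\notin U$. All embeddings are cellular embeddings in closed surfaces, described by rotation systems with edge signatures. An embedding of a digraph is directed if every face is bounded by a directed closed walk. An embedding of a graph (digraph) is bi-eulerian if it has exactly two faces, each bounded by an euler circuit (directed euler circuit). 1. Let $D$ be an eulerian digraph and let $s\neq t$ be vertices of $D$ such that every edge cut separating $s$ and $t$ has at least $4$ arcs. Then $D$ has a directed euler circuit that interlaces $s$ and $t$. 2. Let $D$ be an eulerian digraph with exactly two vertices of degree $\equiv 0 \pmod 4$, and suppose that every edge cut separating these two vertices has at least $4$ arcs. Then $D$ has an orientable bi-eulerian directed embedding; moreover every bi-eulerian embedding of the digraph $D$ is orientable. 3. Let $G$ be an eulerian graph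 with exactly two vertices of degree $\equiv 0 \pmod 4$, and suppose that every edge cut separating these two vertices has at least $4$ edges. Then $G$ has an orientable bi-eulerian embedding. -/

import Mathlib

/-- A graph given by vertices, half-edges, the incidence of half-edges with vertices, and a
fixed-point-free involution `mate` on half-edges. The edges are the pairs `{h, mate h}`; loops and
multiple edges are allowed. -/
structure HalfEdgeGraph (V H : Type*) where
  inc : H → V
  mate : H → H
  mate_mate : ∀ h, mate (mate h) = h
  mate_ne : ∀ h, mate h ≠ h

/-- A digraph: each half-edge is either an outgoing or an incoming half-arc, and `mate` exchanges
the two kinds. The arcs are the pairs `(g, mate g)` with `g` outgoing; such an arc has tail `inc g`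
and head `inc (mate g)`. The underlying undirected graph is `toHalfEdgeGraph`. -/
structure HalfArcDigraph (V H : Type*) extends HalfEdgeGraph V H where
  IsOut : H → Prop
  isOut_mate : ∀ h, IsOut (mate h) ↔ ¬ IsOut h

namespace HalfEdgeGraph

variable {V H : Type*}

/-- The degree: the number of half-edges at `v` (so a loop counts twice). -/
noncomputable def degree (G : HalfEdgeGraph V H) (v : V) : ℕ :=
  {h : H | G.inc h = v}.ncard

/-- `G.IsWalk u l v`: starting at `u` and traversing successively the edges `{g, mate g}`, `g ∈ l`,
each from `inc g` to `inc (mate g)`, is a walk, and it ends at `v`. -/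
def IsWalk (G : HalfEdgeGraph V H) : V → List H → V → Prop
  | u, [], v => u = v
  | u, g :: l, v => G.inc g = u ∧ IsWalk G (G.inc (G.mate g)) l v

/-- `(u, l)` is an euler circuit: a closed walk that uses each edge `{h, mate h}` exactly once
(in one of its two directions) and visits all vertices. -/
def IsEulerCircuit (G : HalfEdgeGraph V H) (u : V) (l : List H) : Prop :=
  G.IsWalk u l u ∧ l.Nodup ∧ (∀ h, Xor (h ∈ l) (G.mate h ∈ l)) ∧
    ∀ v, v = u ∨ ∃ g ∈ l, G.inc g = v

/-- A graph is eulerian if a single circuit contains all its edges and vertices. -/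
def IsEulerian (G : HalfEdgeGraph V H) : Prop :=
  ∃ u l, G.IsEulerCircuit u l

/-- The edge cut between `U` and its complement. Each edge of the cut is represented by its
half-edge at `U`, so the cardinality of this set is the number of edges of the cut. -/
def cut (G : HalfEdgeGraph V H) (U : Set V) : Set H :=
  {h : H | G.inc h ∈ U ∧ G.inc (G.mate h) ∉ U}

/-- Every edge cut separating `s` and `t` has at least `k` edges. -/
def CutsAtLeast (G : HalfEdgeGraph V H) (s t : V) (k : ℕ) : Prop :=
  ∀ U : Set V, s ∈ U → t ∉ U → k ≤ (G.cut U).ncard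

/-- The closed walk with list `l` can be written cyclically as `(… x … y … x … y …)`. -/
def Interlaces (G : HalfEdgeGraph V H) (l : List H) (x y : V) : Prop :=
  ∃ vs : List V, vs ~r l.map G.inc ∧ [x, y, x, y].Sublist vs

/-- A (cellular) embedding of a connected graph, given as a signed rotation system: `rot` is the
clockwise rotation, which permutes the half-edges at each vertex in a single cycle, and `sgn` is
the signature (positive or negative) of each edge. -/
structure Embedding (G : HalfEdgeGraph V H) where
  rot : Equiv.Perm H
  sameCycle_rot : ∀ h k, rot.SameCycle h k ↔ G.inc h = G.inc k
  sgn : H → ℤˣ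
  sgn_mate : ∀ h, sgn (G.mate h) = sgn h

namespace Embedding

variable {G : HalfEdgeGraph V H}

/-- One step of face tracing. The flag `(h, ε)` stands for leaving `inc h` along `h`, on the side of
the edge given by the local orientation `ε`. One arrives through `mate h`; the local orientation
is reversed if the edge is negative; and one leaves along the next half-edge in the rotation,
clockwise or anticlockwise according to the current orientation. -/
def faceStep (Φ : G.Embedding) (x : H × ℤˣ) : H × ℤˣ :=
  ((Φ.rot ^ ((x.2 * Φ.sgn x.1 : ℤˣ) : ℤ)) (G.mate x.1), x.2 * Φ.sgn x.1)

/-- The flag that traverses the same side of the same edge in the opposite direction. -/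
def flagRev (Φ : G.Embedding) (x : H × ℤˣ) : H × ℤˣ :=
  (G.mate x.1, -(x.2 * Φ.sgn x.1))

/-- The faces: flags up to face tracing and reversal of direction. -/
def Face (Φ : G.Embedding) : Type _ :=
  Quot fun x y : H × ℤˣ => y = Φ.faceStep x ∨ y = Φ.flagRev x

/-- The face on whose boundary a flag lies. -/
def face (Φ : G.Embedding) (x : H × ℤˣ) : Φ.Face := Quot.mk _ x

/-- The facial closed walk (starting at `inc x.1`) traced from the flag `x`. -/
noncomputable def facialWalk (Φ : G.Embedding) (x : H × ℤˣ) : List H :=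
  (List.range (Function.minimalPeriod Φ.faceStep x)).map fun i => (Φ.faceStep^[i] x).1

/-- The embedding is orientable: orientations can be chosen at all vertices so that they agree along
every positive edge of the signed rotation system and disagree along every negative edge. -/
def IsOrientable (Φ : G.Embedding) : Prop :=
  ∃ o : V → ℤˣ, ∀ h, Φ.sgn h = o (G.inc h) * o (G.inc (G.mate h))

/-- Exactly two faces, each bounded by an euler circuit. -/
def IsBiEulerian (Φ : G.Embedding) : Prop :=
  Nat.card Φ.Face = 2 ∧
    ∀ f : Φ.Face, ∃ x, Φ.face x = f ∧ G.IsEulerCircuit (G.inc x.1) (Φ.facialWalk x)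

end Embedding

end HalfEdgeGraph

namespace HalfArcDigraph

variable {V H : Type*}

/-- A directed euler circuit: an euler circuit that traverses every arc from tail to head. -/
def IsDirEulerCircuit (D : HalfArcDigraph V H) (u : V) (l : List H) : Prop :=
  D.IsEulerCircuit u l ∧ ∀ g ∈ l, D.IsOut g

/-- A digraph is eulerian if a single directed circuit contains all its arcs and vertices. -/
def IsDirEulerian (D : HalfArcDigraph V H) : Prop :=
  ∃ u l, D.IsDirEulerCircuit u l

/-- Every face of the embedding is bounded by a directed closed walk. -/
def IsDirectedEmbedding (D : HalfArcDigraph V H) (Φ : D.toHalfEdgeGraph.Embedding) : Prop :=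
  ∀ f : Φ.Face, ∃ x, Φ.face x = f ∧ ∀ g ∈ Φ.facialWalk x, D.IsOut g

/-- Exactly two faces, each bounded by a directed euler circuit. -/
def IsDirBiEulerian (D : HalfArcDigraph V H) (Φ : D.toHalfEdgeGraph.Embedding) : Prop :=
  Nat.card Φ.Face = 2 ∧
    ∀ f : Φ.Face, ∃ x, Φ.face x = f ∧ D.IsDirEulerCircuit (D.inc x.1) (Φ.facialWalk x)

end HalfArcDigraph

/-!
The arcs of a digraph, each represented by its outgoing half-arc, form a set `E` with maps
`tail`, `head` to the vertices. A permutation `τ` of `E` with `tail (τ e) = head e` for all `e` is a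
partition of the arcs into directed closed trails, and a directed euler circuit is such a `τ` with a
single cycle. Multiplying `τ` by the transposition of two arcs with the same tail gives another such
permutation, in which two cycles are merged or one is split. This turns all existence claims into
claims about permutations.

*Interlacing circuit.* Since the digraph is balanced, at least two arcs leave every vertex set that
contains `s` but not `t`, so augmenting trails give an arc set `F` that is a flow of value two from
`s` to `t` (`exists_netFlow_eq`). If the transitions of `τ` respect `F` as often as possible, then
cycles of `τ` enter `F` at two places or more at `s`, and leave it only at `t`. So, after a
transposition if necessary, two distinct cycles pass through both `s` and `t`. As the digraph is
connected, all other cycles can be merged into these two (`exists_two_cycles`). Running through one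
of them and then through the other, from `s` to `s`, is an euler circuit that interlaces `s` and `t`.

*Embedding.* An orientable directed embedding with facial euler circuits `σ` and `σ'` exists as soon
as the cycles of `π = σ' * σ⁻¹` are exactly the sets of arcs with a common tail
(`exists_embedding_of_perms`). Let `σ` be the circuit `swap s₁ s₂ * τ`, where `τ` is the pair
of cycles above, containing `s₁, t₁` and `s₂, t₂` respectively. The permutation
`π = swap t₁ t₂ * swap s₁ s₂` has the property that `π * σ = swap t₁ t₂ * τ` has a single
cycle. If `a` lies on a cycle of `π` (possibly a fixed point), and `x`, `y` are two further arcs with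
the same tail that are fixed by `π`, then one of the two 3-cycles on `a, x, y` prolongs the
cycle of `π` and keeps `π * σ` a single cycle (`exists_extend_cycle`). All outdegrees are odd except
those of `s` and `t`, so in this way `π` absorbs, two by two, all arcs.

*Orientability.* In a directed bi-eulerian embedding the two faces alternate at the corners of each
vertex, so the first face leaves a vertex always with the same local orientation. These local
orientations agree along positive edges and disagree along negative ones
(`isOrientable_of_isDirBiEulerian`).

The claim for graphs follows by orienting the edges along an euler circuit.
-/

open Equiv

/-! ### Multiplying a permutation by a transposition -/

section SwapMul

variable {α : Type*}

/-- A reflexive transitive relation that contains every step `u ↦ ρ u` relates any two elements of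
a common cycle. -/
theorem rel_of_sameCycle [Finite α] {ρ : Perm α} {R : α → α → Prop} (refl : ∀ u, R u u)
    (trans : ∀ u v w, R u v → R v w → R u w) (step : ∀ u, R u (ρ u)) {u v : α}
    (h : ρ.SameCycle u v) : R u v := by
  obtain ⟨n, rfl⟩ := h.exists_nat_pow_eq
  induction n with
  | zero => exact refl u
  | succ n ih =>
    rw [pow_succ', Perm.mul_apply]
    exact trans _ _ _ (ih ⟨n, by simp⟩) (step _)

variable [DecidableEq α]

/-- The two permutations agree along an orbit until it meets `x` or `y`. -/
theorem swap_mul_pow_apply {ρ : Perm α} {x y a : α} {n : ℕ}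
    (h : ∀ i, 0 < i → i ≤ n → (ρ ^ i) a ≠ x ∧ (ρ ^ i) a ≠ y) :
    ((swap x y * ρ) ^ n) a = (ρ ^ n) a := by
  induction n with
  | zero => rfl
  | succ n ih =>
    have h' := h (n + 1) (by omega) le_rfl
    rw [pow_succ', Perm.mul_apply, ih fun i hi hin => h i hi (by omega), Perm.mul_apply,
      ← Perm.mul_apply ρ, ← pow_succ', swap_apply_of_ne_of_ne h'.1 h'.2]

variable [Finite α]

/-- Under the product, the cycle of `x` is run through until the step that would close it, which
leads to `y` instead. -/
theorem sameCycle_swap_mul_of_not {ρ : Perm α} {x y : α} (h : ¬ ρ.SameCycle x y) :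
    (swap x y * ρ).SameCycle x y := by
  have hex : ∃ k, 0 < k ∧ (ρ ^ k) x = x :=
    ⟨orderOf ρ, orderOf_pos ρ, by rw [pow_orderOf_eq_one]; rfl⟩
  classical
  obtain ⟨hk, hkx⟩ := Nat.find_spec hex
  obtain ⟨m, hm⟩ : ∃ m, Nat.find hex = m + 1 := ⟨Nat.find hex - 1, by omega⟩
  rw [hm] at hkx
  have h1 : ((swap x y * ρ) ^ m) x = (ρ ^ m) x := by
    refine swap_mul_pow_apply fun i hi him => ⟨fun hx => ?_, fun hy => h ⟨i, by simpa using hy⟩⟩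
    exact Nat.find_min hex (show i < Nat.find hex by omega) ⟨hi, hx⟩
  refine ⟨(m + 1 : ℕ), ?_⟩
  rw [zpow_natCast, pow_succ', Perm.mul_apply, h1, Perm.mul_apply, ← Perm.mul_apply ρ,
    ← pow_succ', hkx, swap_apply_left]

theorem not_sameCycle_swap_mul {ρ : Perm α} {x y : α} (hxy : x ≠ y) (h : ρ.SameCycle x y) :
    ¬ (swap x y * ρ).SameCycle x y := by
  classical
  have hex : ∃ k, (ρ ^ k) x = y := h.exists_nat_pow_eq
  have hky := Nat.find_spec hex
  have hmin : ∀ i, i < Nat.find hex → (ρ ^ i) x ≠ y := fun i hi => Nat.find_min hex hi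
  generalize Nat.find hex = k at hky hmin
  have hk : 0 < k := by
    rcases Nat.eq_zero_or_pos k with rfl | hk
    · exact absurd hky hxy
    · exact hk
  have h1 : ∀ m < k, ((swap x y * ρ) ^ m) x = (ρ ^ m) x := fun m hm => by
    refine swap_mul_pow_apply fun i hi him => ⟨fun hx => ?_, hmin i (by omega)⟩
    refine hmin (k - i) (by omega) ?_
    conv_lhs => rw [← hx]
    rw [← Perm.mul_apply, ← pow_add, Nat.sub_add_cancel (by omega), hky]
  -- under the product, `x` comes back to itself after `k` steps, without having met `y`
  have h2 : ((swap x y * ρ) ^ k) x = x := by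
    obtain ⟨m, rfl⟩ : ∃ m, k = m + 1 := ⟨k - 1, by omega⟩
    rw [pow_succ', Perm.mul_apply, h1 m (by omega), Perm.mul_apply, ← Perm.mul_apply ρ,
      ← pow_succ', hky, swap_apply_right]
  intro h'
  obtain ⟨j, hj⟩ := h'.exists_nat_pow_eq
  have h3 : ∀ q, ((swap x y * ρ) ^ (k * q)) x = x := fun q => by
    rw [pow_mul]
    exact Function.IsFixedPt.perm_pow h2 q
  rw [← Nat.mod_add_div j k, pow_add, Perm.mul_apply, h3, h1 _ (Nat.mod_lt _ hk)] at hj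
  exact hmin _ (Nat.mod_lt _ hk) hj

theorem Equiv.Perm.SameCycle.swap_mul {ρ : Perm α} {x y u v : α} (hxy : ¬ ρ.SameCycle x y)
    (h : ρ.SameCycle u v) : (swap x y * ρ).SameCycle u v := by
  have h0 := sameCycle_swap_mul_of_not hxy
  refine rel_of_sameCycle (R := (swap x y * ρ).SameCycle) (fun _ => .refl _ _)
    (fun _ _ _ h1 h2 => h1.trans h2) (fun u => ?_) h
  have h1 : (swap x y * ρ).SameCycle u ((swap x y * ρ) u) := Perm.sameCycle_apply_right.2 (.refl _ _)
  rw [Perm.mul_apply] at h1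
  by_cases hx : ρ u = x
  · rw [hx, swap_apply_left] at h1
    rw [hx]
    exact h1.trans h0.symm
  by_cases hy : ρ u = y
  · rw [hy, swap_apply_right] at h1
    rw [hy]
    exact h1.trans h0
  rwa [swap_apply_of_ne_of_ne hx hy] at h1

/-- Multiplication by `swap x y` leaves the cycles unchanged outside those of `x` and `y`. -/
theorem Equiv.Perm.SameCycle.swap_mul_or {ρ : Perm α} {u v : α} (x y : α) (h : ρ.SameCycle u v) :
    (swap x y * ρ).SameCycle u v ∨
      (((swap x y * ρ).SameCycle x u ∨ (swap x y * ρ).SameCycle y u) ∧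
        ((swap x y * ρ).SameCycle x v ∨ (swap x y * ρ).SameCycle y v)) := by
  refine rel_of_sameCycle (ρ := ρ) (R := fun u v => (swap x y * ρ).SameCycle u v ∨
      (((swap x y * ρ).SameCycle x u ∨ (swap x y * ρ).SameCycle y u) ∧
        ((swap x y * ρ).SameCycle x v ∨ (swap x y * ρ).SameCycle y v)))
    (fun _ => .inl (.refl _ _)) ?_ (fun u => ?_) h
  · rintro u v w (h1 | ⟨h1, h1'⟩) (h2 | ⟨h2, h2'⟩)
    · exact .inl (h1.trans h2)
    · exact .inr ⟨h2.imp (·.trans h1.symm) (·.trans h1.symm), h2'⟩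
    · exact .inr ⟨h1, h1'.imp (·.trans h2) (·.trans h2)⟩
    · exact .inr ⟨h1, h2'⟩
  · have h1 : (swap x y * ρ).SameCycle u ((swap x y * ρ) u) :=
      Perm.sameCycle_apply_right.2 (.refl _ _)
    rw [Perm.mul_apply] at h1
    by_cases hx : ρ u = x
    · rw [hx, swap_apply_left] at h1
      exact .inr ⟨.inr h1.symm, by rw [hx]; exact .inl (.refl _ _)⟩
    by_cases hy : ρ u = y
    · rw [hy, swap_apply_right] at h1
      exact .inr ⟨.inl h1.symm, by rw [hy]; exact .inr (.refl _ _)⟩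
    rw [swap_apply_of_ne_of_ne hx hy] at h1
    exact .inl h1

theorem Equiv.Perm.SameCycle.of_swap_mul {ρ : Perm α} {x y u v : α} (h : (swap x y * ρ).SameCycle u v) :
    ρ.SameCycle u v ∨ ((ρ.SameCycle x u ∨ ρ.SameCycle y u) ∧
      (ρ.SameCycle x v ∨ ρ.SameCycle y v)) := by
  simpa [← mul_assoc] using Perm.SameCycle.swap_mul_or x y h

/-- Two cycles that cover everything are merged into one. -/
theorem forall_sameCycle_swap_mul {ρ : Perm α} {x y : α} (hxy : ¬ ρ.SameCycle x y)
    (h : ∀ z, ρ.SameCycle x z ∨ ρ.SameCycle y z) (u v : α) : (swap x y * ρ).SameCycle u v := by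
  have h0 := sameCycle_swap_mul_of_not hxy
  have key : ∀ z, (swap x y * ρ).SameCycle x z := fun z =>
    (h z).elim (Perm.SameCycle.swap_mul hxy) fun hz => h0.trans (Perm.SameCycle.swap_mul hxy hz)
  exact (key u).symm.trans (key v)

end SwapMul

/-! ### Two arc-disjoint paths -/

section Flow

variable {V E : Type*} 

/-- The excess of the arcs of `F` leaving `v` over those of `F` entering `v`. -/
def netFlow [DecidableEq V] (tail head : E → V) (F : Finset E) (v : V) : ℤ :=
  ∑ e ∈ F, ((if tail e = v then 1 else 0) - (if head e = v then 1 else 0))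

/-- The net flow out of a vertex set. -/
theorem sum_netFlow [Fintype V] [DecidableEq V] {tail head : E → V} (F : Finset E)
    (P : V → Prop) [DecidablePred P] :
    ∑ v with P v, netFlow tail head F v =
      ∑ e ∈ F, ((if P (tail e) then 1 else 0) - (if P (head e) then 1 else 0) : ℤ) := by
  unfold netFlow
  rw [Finset.sum_comm]
  refine Finset.sum_congr rfl fun e _ => ?_
  rw [Finset.sum_sub_distrib, Finset.sum_ite_eq, Finset.sum_ite_eq]
  simp

variable [DecidableEq E]

/-- `AugTrail tail head F s p w`: there is a trail from `s` to `w` with arc set `p` in the residual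
digraph of `F`, the digraph in which the arcs of `F` are reversed. -/
inductive AugTrail (tail head : E → V) (F : Finset E) (s : V) : Finset E → V → Prop
  | nil : AugTrail tail head F s ∅ s
  | forward {p : Finset E} (e : E) : AugTrail tail head F s p (tail e) → e ∉ p → e ∉ F →
      AugTrail tail head F s (insert e p) (head e)
  | backward {p : Finset E} (e : E) : AugTrail tail head F s p (head e) → e ∉ p → e ∈ F →
      AugTrail tail head F s (insert e p) (tail e)

variable {tail head : E → V} {F : Finset E} {s : V}

/-- The trail may be stopped after any of its arcs, at the end of this arc. -/
theorem AugTrail.exists_of_mem {p : Finset E} {w : V} (h : AugTrail tail head F s p w) {e : E}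
    (he : e ∈ p) : ∃ q, AugTrail tail head F s q (if e ∈ F then tail e else head e) := by
  induction h with
  | nil => simp at he
  | forward e' h1 h2 h3 ih =>
    rcases Finset.mem_insert.1 he with rfl | he
    · exact ⟨_, by rw [if_neg h3]; exact .forward e h1 h2 h3⟩
    · exact ih he
  | backward e' h1 h2 h3 ih =>
    rcases Finset.mem_insert.1 he with rfl | he
    · exact ⟨_, by rw [if_pos h3]; exact .backward e h1 h2 h3⟩
    · exact ih he

variable [DecidableEq V]

/-- Exchanging along a trail of the residual digraph sends one more unit from its start to its
end. -/
theorem AugTrail.netFlow_symmDiff {p : Finset E} {w : V} (h : AugTrail tail head F s p w) (v : V) :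
    netFlow tail head (symmDiff F p) v =
      netFlow tail head F v + (if s = v then 1 else 0) - (if w = v then 1 else 0) := by
  induction h with
  | nil => simp [symmDiff]
  | @forward p e h1 h2 h3 ih =>
    have h4 : symmDiff F (insert e p) = insert e (symmDiff F p) := by
      ext x; simp only [Finset.mem_symmDiff, Finset.mem_insert]; grind
    have h5 : e ∉ symmDiff F p := by simp [Finset.mem_symmDiff, h2, h3]
    unfold netFlow at ih ⊢
    rw [h4, Finset.sum_insert h5, ih]
    ring
  | @backward p e h1 h2 h3 ih =>
    have h4 : symmDiff F (insert e p) = (symmDiff F p).erase e := by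
      ext x; simp only [Finset.mem_symmDiff, Finset.mem_insert, Finset.mem_erase]; grind
    have h5 : e ∈ symmDiff F p := by simp [Finset.mem_symmDiff, h2, h3]
    unfold netFlow at ih ⊢
    rw [h4, Finset.sum_erase_eq_sub h5, ih]
    ring

variable [Fintype V] [Fintype E] {t : V} {n : ℕ}

/-- If at least `n` arcs leave every vertex set that contains `s` and not `t`, then the residual digraph
of a flow of value `k < n` has a trail from `s` to `t`: otherwise exactly `k` arcs would leave the
set of vertices that can be reached from `s`. -/
theorem exists_augTrail
    (hcut : ∀ P : V → Prop, P s → ¬ P t → n ≤ {e | P (tail e) ∧ ¬ P (head e)}.ncard)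
    {k : ℕ} (hk : k < n)
    (hF : ∀ v, netFlow tail head F v = k * ((if s = v then 1 else 0) - (if t = v then 1 else 0))) :
    ∃ p, AugTrail tail head F s p t := by
  classical
  by_contra ht
  set P : V → Prop := fun w => ∃ p, AugTrail tail head F s p w with hP
  have hs : P s := ⟨_, .nil⟩
  have hfwd : ∀ e, e ∉ F → P (tail e) → P (head e) := by
    rintro e he ⟨p, hp⟩
    by_cases hep : e ∈ p
    · simpa [he] using hp.exists_of_mem hep
    · exact ⟨_, .forward e hp hep he⟩
  have hbwd : ∀ e, e ∈ F → P (head e) → P (tail e) := by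
    rintro e he ⟨p, hp⟩
    by_cases hep : e ∈ p
    · simpa [he] using hp.exists_of_mem hep
    · exact ⟨_, .backward e hp hep he⟩
  have h1 := sum_netFlow (tail := tail) (head := head) F P
  have h2 : ∑ v with P v, netFlow tail head F v = k := by
    rw [Finset.sum_congr rfl fun v _ => hF v, ← Finset.mul_sum, Finset.sum_sub_distrib,
      Finset.sum_ite_eq, Finset.sum_ite_eq]
    simp [hs, show ¬ P t from ht]
  have h3 : ∑ e ∈ F, ((if P (tail e) then 1 else 0) - (if P (head e) then 1 else 0) : ℤ) =
      ({e | P (tail e) ∧ ¬ P (head e)}.ncard : ℕ) := by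
    have h4 : {e | P (tail e) ∧ ¬ P (head e)} = ↑(F.filter fun e => P (tail e) ∧ ¬ P (head e)) := by
      ext e
      have := hfwd e
      simp only [Set.mem_ofPred_eq, Finset.coe_filter]
      tauto
    rw [h4, Set.ncard_coe_finset, Finset.card_filter, Nat.cast_sum]
    refine Finset.sum_congr rfl fun e he => ?_
    have := hbwd e he
    by_cases h4 : P (head e) <;> by_cases h5 : P (tail e) <;> simp_all
  have h4 := hcut P hs ht
  omega

/-- Menger's theorem for arc-disjoint paths, in terms of flows: if at least `n` arcs leave every
vertex set that contains `s` and not `t`, there is a flow of every value `k ≤ n` from `s` to `t`. -/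
theorem exists_netFlow_eq
    (hcut : ∀ P : V → Prop, P s → ¬ P t → n ≤ {e | P (tail e) ∧ ¬ P (head e)}.ncard)
    : ∀ k ≤ n, ∃ F : Finset E, ∀ v,
      netFlow tail head F v = k * ((if s = v then 1 else 0) - (if t = v then 1 else 0))
  | 0, _ => ⟨∅, by simp [netFlow]⟩
  | k + 1, hk => by
    obtain ⟨F, hF⟩ := exists_netFlow_eq hcut k (by omega)
    obtain ⟨p, hp⟩ := exists_augTrail hcut (by omega) hF
    refine ⟨symmDiff F p, fun v => ?_⟩
    rw [hp.netFlow_symmDiff, hF]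
    push_cast
    ring

end Flow

/-! ### Trails along two circuits through `s` and `t` -/

section Transitions

variable {V E : Type*} {tail head : E → V}

/-- `tail (τ e) = head e` for all `e` means that the cycles of `τ` are closed trails. Exchanging two
arcs with the same tail preserves this. -/
theorem tail_swap_mul [DecidableEq E] {τ : Perm E} (hτ : ∀ e, tail (τ e) = head e) {x y : E}
    (hxy : tail x = tail y) (e : E) : tail ((swap x y * τ) e) = head e := by
  rw [Perm.mul_apply, swap_apply_def, ← hτ]
  split_ifs with h1 h2
  · rw [h1, hxy]
  · rw [h2, hxy]
  · rfl

theorem symm_swap_mul_apply [DecidableEq E] (τ : Perm E) (x y z : E) :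
    (swap x y * τ).symm z = τ.symm (swap x y z) := rfl

/-- An arc of `F` whose predecessor is not in `F`, on a cycle of `τ`, forces an arc not in `F` whose
predecessor is in `F`. -/
theorem exists_leave_of_enter [Finite E] {τ : Perm E} {F : Finset E} {x : E} (hx : x ∈ F)
    (hx' : τ.symm x ∉ F) : ∃ y, τ.SameCycle x y ∧ y ∉ F ∧ τ.symm y ∈ F := by
  by_contra! h
  have key : ∀ n : ℕ, (τ ^ n) x ∈ F := fun n => by
    induction n with
    | zero => exact hx
    | succ n ih =>
      by_contra hn
      refine h _ ⟨(n + 1 : ℕ), by rw [zpow_natCast]⟩ hn ?_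
      rwa [pow_succ', Perm.mul_apply, Equiv.symm_apply_apply]
  have hc : τ.SameCycle x (τ.symm x) := by
    rw [← Perm.sameCycle_apply_right, apply_symm_apply]
  obtain ⟨n, hn⟩ := hc.exists_nat_pow_eq
  exact hx' (hn ▸ key n)

variable [Fintype E] [DecidableEq E]

/-- Transitions can be chosen so that they preserve membership in `F` as often as possible: at no
vertex is `F` both left and entered. -/
theorem exists_transitions (F : Finset E) {σ : Perm E} (hσ : ∀ e, tail (σ e) = head e) :
    ∃ τ : Perm E, (∀ e, tail (τ e) = head e) ∧
      ∀ x y, tail x = tail y → x ∉ F → τ.symm x ∈ F → y ∈ F → τ.symm y ∈ F := by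
  obtain ⟨τ, hτ, hmax⟩ := Set.exists_max_image {τ : Perm E | ∀ e, tail (τ e) = head e}
    (fun τ => (Finset.univ.filter fun z => τ.symm z ∈ F ↔ z ∈ F).card) (Set.toFinite _) ⟨σ, hσ⟩
  refine ⟨τ, hτ, fun x y hxy hx hx' hy => ?_⟩
  by_contra hy'
  refine absurd (hmax (swap x y * τ) (tail_swap_mul hτ hxy)) (not_le.2 (Finset.card_lt_card ?_))
  rw [Finset.ssubset_iff_of_subset]
  · exact ⟨x, Finset.mem_filter.2 ⟨Finset.mem_univ _, by simp [hx, hy', symm_swap_mul_apply]⟩,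
      by simp [hx, hx']⟩
  · intro z
    rw [Finset.mem_filter, Finset.mem_filter]
    rintro ⟨-, hz⟩
    have h1 : z ≠ x := by rintro rfl; exact hx (hz.1 hx')
    have h2 : z ≠ y := by rintro rfl; exact hy' (hz.2 hy)
    rw [symm_swap_mul_apply, swap_apply_of_ne_of_ne h1 h2]
    exact ⟨Finset.mem_univ _, hz⟩

variable [DecidableEq V]

theorem netFlow_eq_enter_sub_leave (F : Finset E) {τ : Perm E} (hτ : ∀ e, tail (τ e) = head e)
    (v : V) : netFlow tail head F v =
      (Finset.univ.filter fun x => tail x = v ∧ x ∈ F ∧ τ.symm x ∉ F).card -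
        (Finset.univ.filter fun x => tail x = v ∧ x ∉ F ∧ τ.symm x ∈ F).card := by
  have h1 : ∑ e ∈ F, (if head e = v then 1 else 0 : ℤ) =
      ∑ x, if tail x = v ∧ τ.symm x ∈ F then 1 else 0 := by
    rw [← Equiv.sum_comp τ, ← Fintype.sum_ite_mem]
    refine Finset.sum_congr rfl fun e _ => ?_
    by_cases he : e ∈ F <;> simp [he, hτ]
  have h2 : ∑ e ∈ F, (if tail e = v then 1 else 0 : ℤ) =
      ∑ x, if tail x = v ∧ x ∈ F then 1 else 0 := by
    rw [← Fintype.sum_ite_mem]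
    refine Finset.sum_congr rfl fun e _ => ?_
    by_cases he : e ∈ F <;> simp [he]
  rw [netFlow, Finset.sum_sub_distrib, h1, h2, Finset.card_filter, Finset.card_filter]
  push_cast
  rw [← Finset.sum_sub_distrib, ← Finset.sum_sub_distrib]
  refine Finset.sum_congr rfl fun e _ => ?_
  by_cases h3 : tail e = v <;> by_cases h4 : e ∈ F <;> by_cases h5 : τ.symm e ∈ F <;>
    simp [h3, h4, h5]

/-- Two of the cycles of a suitable `τ` visit both `s` and `t`. If `F` is a flow of value two from `s`
to `t`, then these are the cycles that enter `F` at `s`: they have to leave `F` again, at `t`. -/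
theorem exists_two_cycles_aux [Fintype V] {σ : Perm E} (hσ : ∀ e, tail (σ e) = head e) {s t : V}
    (hst : s ≠ t)
    (hcut : ∀ P : V → Prop, P s → ¬ P t → 2 ≤ {e | P (tail e) ∧ ¬ P (head e)}.ncard) :
    ∃ (τ : Perm E) (s₁ s₂ t₁ t₂ : E), (∀ e, tail (τ e) = head e) ∧
      tail s₁ = s ∧ tail s₂ = s ∧ tail t₁ = t ∧ tail t₂ = t ∧
      τ.SameCycle s₁ t₁ ∧ τ.SameCycle s₂ t₂ ∧ ¬ τ.SameCycle t₁ t₂ := by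
  obtain ⟨F, hF⟩ := exists_netFlow_eq hcut 2 le_rfl
  obtain ⟨τ, hτ, hτF⟩ := exists_transitions F hσ
  have hleave : ∀ x, x ∉ F → τ.symm x ∈ F → tail x = t := by
    intro x hx hx'
    by_contra hxt
    have h1 := hF (tail x)
    rw [netFlow_eq_enter_sub_leave F hτ, if_neg (Ne.symm hxt)] at h1
    have h2 : (Finset.univ.filter fun y => tail y = tail x ∧ y ∈ F ∧ τ.symm y ∉ F) = ∅ := by
      ext y
      simpa using fun hy => hτF x y hy.symm hx hx'
    have h3 : 0 < (Finset.univ.filter fun y => tail y = tail x ∧ y ∉ F ∧ τ.symm y ∈ F).card :=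
      Finset.card_pos.2 ⟨x, by simp [hx, hx']⟩
    rw [h2, Finset.card_empty] at h1
    have h4 : (0 : ℤ) ≤ if s = tail x then 1 else 0 := by split_ifs <;> simp
    push_cast at h1
    omega
  have henter : 1 < (Finset.univ.filter fun x => tail x = s ∧ x ∈ F ∧ τ.symm x ∉ F).card := by
    have h1 := hF s
    rw [netFlow_eq_enter_sub_leave F hτ, if_pos rfl, if_neg hst.symm] at h1
    push_cast at h1
    omega
  obtain ⟨s₁, hs₁, s₂, hs₂, hne⟩ := Finset.one_lt_card.1 henter
  simp only [Finset.mem_filter, Finset.mem_univ, true_and] at hs₁ hs₂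
  have key : ∀ τ : Perm E, (∀ e, tail (τ e) = head e) → (∀ x, x ∉ F → τ.symm x ∈ F → tail x = t) →
      τ.symm s₁ ∉ F → τ.symm s₂ ∉ F → ¬ τ.SameCycle s₁ s₂ →
      ∃ (τ : Perm E) (s₁ s₂ t₁ t₂ : E), (∀ e, tail (τ e) = head e) ∧
      tail s₁ = s ∧ tail s₂ = s ∧ tail t₁ = t ∧ tail t₂ = t ∧
      τ.SameCycle s₁ t₁ ∧ τ.SameCycle s₂ t₂ ∧ ¬ τ.SameCycle t₁ t₂ := by
    intro τ hτ hleave h₁ h₂ hn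
    obtain ⟨t₁, h1, h2, h3⟩ := exists_leave_of_enter hs₁.2.1 h₁
    obtain ⟨t₂, h1', h2', h3'⟩ := exists_leave_of_enter hs₂.2.1 h₂
    exact ⟨τ, s₁, s₂, t₁, t₂, hτ, hs₁.1, hs₂.1, hleave _ h2 h3, hleave _ h2' h3', h1, h1',
      fun h => hn ((h1.trans h).trans h1'.symm)⟩
  by_cases hc : τ.SameCycle s₁ s₂
  · -- exchanging `s₁` and `s₂` splits the common cycle
    refine key (swap s₁ s₂ * τ) (tail_swap_mul hτ (hs₁.1.trans hs₂.1.symm)) ?_ ?_ ?_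
      (not_sameCycle_swap_mul hne hc)
    · intro x hx hx'
      have h1 : x ≠ s₁ := by rintro rfl; exact hx hs₁.2.1
      have h2 : x ≠ s₂ := by rintro rfl; exact hx hs₂.2.1
      rw [symm_swap_mul_apply, swap_apply_of_ne_of_ne h1 h2] at hx'
      exact hleave x hx hx'
    · simpa [symm_swap_mul_apply] using hs₂.2.2
    · simpa [symm_swap_mul_apply] using hs₁.2.2
  · exact key τ hτ hleave hs₁.2.2 hs₂.2.2 hc

/-- In a connected balanced digraph in which at least two arcs leave every vertex set that contains
`s` and not `t`, the arcs can be partitioned into two closed trails that both visit `s` and `t`. -/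
theorem exists_two_cycles [Fintype V] {σ : Perm E} (hσ : ∀ e, tail (σ e) = head e)
    (hcyc : ∀ x y, σ.SameCycle x y) {s t : V} (hst : s ≠ t)
    (hcut : ∀ P : V → Prop, P s → ¬ P t → 2 ≤ {e | P (tail e) ∧ ¬ P (head e)}.ncard) :
    ∃ (τ : Perm E) (s₁ s₂ t₁ t₂ : E), (∀ e, tail (τ e) = head e) ∧
      tail s₁ = s ∧ tail s₂ = s ∧ tail t₁ = t ∧ tail t₂ = t ∧
      τ.SameCycle s₁ t₁ ∧ τ.SameCycle s₂ t₂ ∧ ¬ τ.SameCycle t₁ t₂ ∧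
      ∀ x, τ.SameCycle t₁ x ∨ τ.SameCycle t₂ x := by
  classical
  obtain ⟨τ₀, s₁, s₂, t₁, t₂, hτ₀, hs₁, hs₂, ht₁, ht₂, h1₀, h2₀, hn₀⟩ :=
    exists_two_cycles_aux hσ hst hcut
  -- the two cycles through `s` and `t` are chosen as long as possible
  obtain ⟨τ, ⟨hτ, h1, h2, hn⟩, hmax⟩ := Set.exists_max_image
    {τ : Perm E | (∀ e, tail (τ e) = head e) ∧ τ.SameCycle s₁ t₁ ∧ τ.SameCycle s₂ t₂ ∧
      ¬ τ.SameCycle t₁ t₂}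
    (fun τ => (Finset.univ.filter fun z => τ.SameCycle t₁ z ∨ τ.SameCycle t₂ z).card)
    (Set.toFinite _) ⟨τ₀, hτ₀, h1₀, h2₀, hn₀⟩
  refine ⟨τ, s₁, s₂, t₁, t₂, hτ, hs₁, hs₂, ht₁, ht₂, h1, h2, hn, fun z => ?_⟩
  by_contra hz
  obtain ⟨e, he, he'⟩ : ∃ e, (τ.SameCycle t₁ e ∨ τ.SameCycle t₂ e) ∧
      ¬ (τ.SameCycle t₁ (σ e) ∨ τ.SameCycle t₂ (σ e)) := by
    by_contra! hcl
    refine hz (rel_of_sameCycle (ρ := σ)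
      (R := fun u v => (τ.SameCycle t₁ u ∨ τ.SameCycle t₂ u) →
        (τ.SameCycle t₁ v ∨ τ.SameCycle t₂ v))
      (fun _ => id) (fun _ _ _ f g => g ∘ f) ?_ (hcyc t₁ z) (.inl (.refl _ _)))
    intro u hu
    by_contra hu'
    rw [not_or] at hu'
    exact (hcl u hu).elim hu'.1 hu'.2
  set x := τ e with hx
  set y := σ e with hy
  have hxs : τ.SameCycle t₁ x ∨ τ.SameCycle t₂ x := by
    simpa [hx, Perm.sameCycle_apply_right] using he
  rw [not_or] at he'
  have hxy : ¬ τ.SameCycle x y := fun h =>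
    hxs.elim (fun h' => he'.1 (h'.trans h)) (fun h' => he'.2 (h'.trans h))
  have hmono {u v : E} (h : τ.SameCycle u v) := Perm.SameCycle.swap_mul hxy h
  have hn' : ¬ (swap x y * τ).SameCycle t₁ t₂ := by
    intro h
    rcases h.of_swap_mul with h | ⟨h1, h2⟩
    · exact hn h
    · have h1 := h1.resolve_right fun h => he'.1 h.symm
      have h2 := h2.resolve_right fun h => he'.2 h.symm
      exact hn (h1.symm.trans h2)
  refine absurd (hmax (swap x y * τ)
    ⟨tail_swap_mul hτ (by rw [hx, hy, hτ, hσ]), hmono h1, hmono h2, hn'⟩)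
    (not_le.2 (Finset.card_lt_card ?_))
  rw [Finset.ssubset_iff_of_subset]
  · refine ⟨y, ?_, by simp [he'.1, he'.2]⟩
    have := sameCycle_swap_mul_of_not hxy
    simpa using hxs.imp (fun h => (hmono h).trans this) (fun h => (hmono h).trans this)
  · intro z
    simpa using Or.imp hmono hmono

end Transitions

/-! ### Permutations with prescribed orbits whose product with a long cycle is a long cycle -/

section Blocks

variable {V E : Type*} [Fintype E] [DecidableEq E] [DecidableEq V] {b : E → V} {σ : Perm E}

/-- The cycle of `π` through `a` can be prolonged by two fixed points `x`, `y` of `π` in the same block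
of `b`, so that `π * σ` still has a single cycle. The set `A` holds the elements that already belong
to the cycles of `π`; the assumption `hc` can be achieved by exchanging `x` and `y`. -/
theorem exists_extend_cycle {π : Perm E} {A : Finset E} (hb : ∀ z, b (π z) = b z)
    (hfix : ∀ z ∉ A, π z = z) (hsame : ∀ u ∈ A, ∀ v ∈ A, b u = b v → π.SameCycle u v)
    (hcyc : ∀ u v, (π * σ).SameCycle u v) {a x y : E} (ha : a ∈ A) (hx : x ∉ A) (hy : y ∉ A)
    (hxy : x ≠ y) (hax : b a = b x) (hay : b a = b y)
    (hc : (swap x y * (π * σ)).SameCycle a x) :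
    ∃ π' : Perm E, (∀ z, b (π' z) = b z) ∧ (∀ z ∉ insert x (insert y A), π' z = z) ∧
      (∀ u ∈ insert x (insert y A), ∀ v ∈ insert x (insert y A), b u = b v → π'.SameCycle u v) ∧
      ∀ u v, (π' * σ).SameCycle u v := by
  have hne : ∀ {u w}, u ∈ A → w ∉ A → u ≠ w := fun hu hw h => hw (h ▸ hu)
  have hfixc : ∀ {u w}, u ∉ A → π.SameCycle u w → u = w := fun hu h =>
    (Perm.SameCycle.eq_of_left h (hfix _ hu))
  have hn1 : ¬ π.SameCycle x y := fun h => hxy (hfixc hx h)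
  have hn2 : ¬ (swap x y * π).SameCycle a y := by
    intro h
    rcases h.of_swap_mul with h | ⟨h | h, -⟩
    · exact hne ha hy (hfixc hy h.symm).symm
    · exact hne ha hx (hfixc hx h).symm
    · exact hne ha hy (hfixc hy h).symm
  have hm {u v} (h : π.SameCycle u v) : (swap a y * (swap x y * π)).SameCycle u v :=
    (h.swap_mul hn1).swap_mul hn2
  refine ⟨swap a y * (swap x y * π), ?_, ?_, ?_, ?_⟩
  · exact tail_swap_mul (tail_swap_mul hb (hax.symm.trans hay)) hay
  · intro z hz
    simp only [Finset.mem_insert, not_or] at hz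
    rw [Perm.mul_apply, Perm.mul_apply, hfix z hz.2.2, swap_apply_of_ne_of_ne hz.1 hz.2.1,
      swap_apply_of_ne_of_ne (hne ha hz.2.2).symm hz.2.1]
  · have h1 : (swap a y * (swap x y * π)).SameCycle a y := sameCycle_swap_mul_of_not hn2
    have h2 : (swap a y * (swap x y * π)).SameCycle a x :=
      h1.trans ((sameCycle_swap_mul_of_not hn1).swap_mul hn2).symm
    have key : ∀ u ∈ insert x (insert y A), b u = b a →
        (swap a y * (swap x y * π)).SameCycle a u := by
      intro u hu hua
      simp only [Finset.mem_insert] at hu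
      rcases hu with rfl | rfl | hu
      · exact h2
      · exact h1
      · exact hm (hsame a ha u hu hua.symm)
    intro u hu v hv huv
    by_cases hua : b u = b a
    · exact (key u hu hua).symm.trans (key v hv (huv.symm.trans hua))
    · have mem : ∀ w ∈ insert x (insert y A), b w = b u → w ∈ A := by
        intro w hw hwu
        simp only [Finset.mem_insert] at hw
        rcases hw with rfl | rfl | hw
        · exact absurd (hwu.symm.trans hax.symm) hua
        · exact absurd (hwu.symm.trans hay.symm) hua
        · exact hw
      exact hm (hsame u (mem u hu rfl) v (mem v hv huv.symm) huv)
  · have hn3 : ¬ (swap x y * (π * σ)).SameCycle x y := not_sameCycle_swap_mul hxy (hcyc x y)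
    have hn4 : ¬ (swap x y * (π * σ)).SameCycle a y := fun h => hn3 (hc.symm.trans h)
    intro u v
    rw [mul_assoc, mul_assoc]
    refine forall_sameCycle_swap_mul hn4 (fun z => ?_) u v
    rcases (hcyc x z).swap_mul_or x y with h | ⟨-, h | h⟩
    · exact .inl (hc.trans h)
    · exact .inl (hc.trans h)
    · exact .inr h

/-- Fixed points of `π` are absorbed two at a time, until the cycles of `π` are the blocks of `b`. -/
theorem exists_full_cycles (A : Finset E) (π : Perm E) (hb : ∀ z, b (π z) = b z)
    (hfix : ∀ z ∉ A, π z = z) (hsame : ∀ u ∈ A, ∀ v ∈ A, b u = b v → π.SameCycle u v)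
    (hcyc : ∀ u v, (π * σ).SameCycle u v) (hrep : ∀ z, ∃ a ∈ A, b a = b z)
    (heven : ∀ v, Even (Aᶜ.filter fun z => b z = v).card) :
    ∃ π : Perm E, (∀ z, b (π z) = b z) ∧ (∀ u v, b u = b v → π.SameCycle u v) ∧
      ∀ u v, (π * σ).SameCycle u v := by
  induction h : Aᶜ.card using Nat.strong_induction_on generalizing A π with
  | _ n ih =>
    by_cases hA : ∀ z, z ∈ A
    · exact ⟨π, hb, fun u v => hsame u (hA u) v (hA v), hcyc⟩
    push Not at hA
    obtain ⟨x, hx⟩ := hA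
    have hxm : x ∈ Aᶜ.filter fun z => b z = b x := by simp [hx]
    obtain ⟨y, hy, hyx⟩ : ∃ y ∈ Aᶜ.filter fun z => b z = b x, y ≠ x := by
      refine Finset.exists_mem_ne ?_ x
      have h1 := Finset.card_pos.2 ⟨x, hxm⟩
      obtain ⟨k, hk⟩ := heven (b x)
      omega
    have hym := hy
    simp only [Finset.mem_filter, Finset.mem_compl] at hy
    obtain ⟨a, ha, hax⟩ := hrep x
    have hcompl : (insert x (insert y A))ᶜ = (Aᶜ.erase y).erase x := by
      rw [Finset.compl_insert, Finset.compl_insert]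
    have hext : ∃ π' : Perm E, (∀ z, b (π' z) = b z) ∧
        (∀ z ∉ insert x (insert y A), π' z = z) ∧
        (∀ u ∈ insert x (insert y A), ∀ v ∈ insert x (insert y A),
          b u = b v → π'.SameCycle u v) ∧ ∀ u v, (π' * σ).SameCycle u v := by
      have h1 := (hcyc x a).swap_mul_or x y
      have h2 : (swap x y * (π * σ)).SameCycle a x ∨ (swap x y * (π * σ)).SameCycle a y := by
        rcases h1 with h | ⟨-, h | h⟩
        · exact .inl h.symm
        · exact .inl h.symm
        · exact .inr h.symm
      rcases h2 with h2 | h2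
      · exact exists_extend_cycle hb hfix hsame hcyc ha hx hy.1 hyx.symm hax
          (hax.trans hy.2.symm) h2
      · rw [swap_comm] at h2
        rw [Finset.insert_comm]
        exact exists_extend_cycle hb hfix hsame hcyc ha hy.1 hx hyx (hax.trans hy.2.symm) hax h2
    obtain ⟨π', hb', hfix', hsame', hcyc'⟩ := hext
    refine ih _ ?_ (insert x (insert y A)) π' hb' hfix' hsame' hcyc' ?_ ?_ rfl
    · rw [← h]
      refine Finset.card_lt_card ?_
      rw [Finset.compl_ssubset_compl, Finset.ssubset_iff_of_subset]
      · exact ⟨x, by simp, hx⟩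
      · intro z hz; simp [hz]
    · intro z
      obtain ⟨c, hc, hcz⟩ := hrep z
      exact ⟨c, by simp [hc], hcz⟩
    · intro v
      rw [hcompl, Finset.filter_erase, Finset.filter_erase]
      by_cases hv : b x = v
      · subst hv
        rw [Finset.card_erase_of_mem (Finset.mem_erase.2 ⟨hyx.symm, hxm⟩),
          Finset.card_erase_of_mem hym]
        obtain ⟨k, hk⟩ := heven (b x)
        exact ⟨k - 1, by omega⟩
      · rw [Finset.erase_eq_of_notMem, Finset.erase_eq_of_notMem]
        · exact heven v
        · simp [hy.2, hv]
        · simp [hv]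

/-- If all blocks of `b` are odd, except for the two blocks over `s` and `t`, and if `τ` has two
cycles, both of which meet both of these blocks, then merging the two cycles at the block over `s`
gives a long cycle `σ`, and there is a `π` whose cycles are the blocks such that `π * σ` is a long
cycle too. -/
theorem exists_blocks_of_two_cycles {τ : Perm E} {s₁ s₂ t₁ t₂ : E} {s t : V} (hst : s ≠ t)
    (hs₁ : b s₁ = s) (hs₂ : b s₂ = s) (ht₁ : b t₁ = t) (ht₂ : b t₂ = t)
    (h1 : τ.SameCycle s₁ t₁) (h2 : τ.SameCycle s₂ t₂) (hn : ¬ τ.SameCycle t₁ t₂)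
    (hcov : ∀ x, τ.SameCycle t₁ x ∨ τ.SameCycle t₂ x)
    (hne : ∀ v, ∃ x, b x = v)
    (hodd : ∀ v, Even (Finset.univ.filter fun z => b z = v).card ↔ v = s ∨ v = t) :
    (∀ u v, (swap s₁ s₂ * τ).SameCycle u v) ∧
    ∃ π : Perm E, (∀ z, b (π z) = b z) ∧ (∀ u v, b u = b v → π.SameCycle u v) ∧
      ∀ u v, (π * (swap s₁ s₂ * τ)).SameCycle u v := by
  have hns : ¬ τ.SameCycle s₁ s₂ := fun h => hn ((h1.symm.trans h).trans h2)
  have hs12 : s₁ ≠ s₂ := by rintro rfl; exact hns (.refl _ _)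
  have ht12 : t₁ ≠ t₂ := by rintro rfl; exact hn (.refl _ _)
  have hdisj : ∀ {x y}, b x = s → b y = t → x ≠ y := by
    rintro x y hx hy rfl; exact hst (hx.symm.trans hy)
  refine ⟨forall_sameCycle_swap_mul hns fun z => (hcov z).imp h1.trans h2.trans, ?_⟩
  choose r hr using hne
  -- one representative of each odd block, two elements of each even block
  set A : Finset E := Finset.univ.filter fun x =>
    x = s₁ ∨ x = s₂ ∨ x = t₁ ∨ x = t₂ ∨ (b x ≠ s ∧ b x ≠ t ∧ x = r (b x)) with hA
  have hAs : ∀ z ∈ A, b z = s → z = s₁ ∨ z = s₂ := by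
    intro z hz hzs
    simp only [hA, Finset.mem_filter, Finset.mem_univ, true_and] at hz
    rcases hz with h | h | rfl | rfl | h
    · exact .inl h
    · exact .inr h
    · exact absurd rfl (hdisj hzs ht₁)
    · exact absurd rfl (hdisj hzs ht₂)
    · exact absurd hzs h.1
  have hAt : ∀ z ∈ A, b z = t → z = t₁ ∨ z = t₂ := by
    intro z hz hzt
    simp only [hA, Finset.mem_filter, Finset.mem_univ, true_and] at hz
    rcases hz with rfl | rfl | h | h | h
    · exact absurd rfl (hdisj hs₁ hzt)
    · exact absurd rfl (hdisj hs₂ hzt)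
    · exact .inl h
    · exact .inr h
    · exact absurd hzt h.2.1
  have hAo : ∀ z ∈ A, b z ≠ s → b z ≠ t → z = r (b z) := by
    intro z hz hzs hzt
    simp only [hA, Finset.mem_filter, Finset.mem_univ, true_and] at hz
    rcases hz with rfl | rfl | rfl | rfl | h
    · exact absurd hs₁ hzs
    · exact absurd hs₂ hzs
    · exact absurd ht₁ hzt
    · exact absurd ht₂ hzt
    · exact h.2.2
  have hm : s₁ ∈ A ∧ s₂ ∈ A ∧ t₁ ∈ A ∧ t₂ ∈ A := by simp [hA]
  have hmr : ∀ v, v ≠ s → v ≠ t → r v ∈ A := fun v hs ht => by simp [hA, hr, hs, ht]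
  have hn1 : ¬ (1 : Perm E).SameCycle s₁ s₂ := by simpa [Perm.sameCycle_one] using hs12
  have hn2 : ¬ (swap s₁ s₂ * 1).SameCycle t₁ t₂ := by
    intro h
    rcases h.of_swap_mul with h | ⟨h | h, -⟩
    · exact ht12 (by simpa using h)
    · exact hdisj hs₁ ht₁ (by simpa using h)
    · exact hdisj hs₂ ht₁ (by simpa using h)
  refine exists_full_cycles A (swap t₁ t₂ * (swap s₁ s₂ * 1)) ?_ ?_ ?_ ?_ ?_ ?_
  · exact tail_swap_mul (tail_swap_mul (fun e => rfl) (hs₁.trans hs₂.symm)) (ht₁.trans ht₂.symm)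
  · intro z hz
    have : ∀ a ∈ A, z ≠ a := by rintro _ ha rfl; exact hz ha
    rw [mul_one, Perm.mul_apply, swap_apply_of_ne_of_ne (this _ hm.1) (this _ hm.2.1),
      swap_apply_of_ne_of_ne (this _ hm.2.2.1) (this _ hm.2.2.2)]
  · have hss : (swap t₁ t₂ * (swap s₁ s₂ * 1)).SameCycle s₁ s₂ :=
      (sameCycle_swap_mul_of_not hn1).swap_mul hn2
    have htt : (swap t₁ t₂ * (swap s₁ s₂ * 1)).SameCycle t₁ t₂ := sameCycle_swap_mul_of_not hn2
    intro u hu v hv huv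
    by_cases hs : b u = s
    · rcases hAs u hu hs with rfl | rfl <;> rcases hAs v hv (huv.symm.trans hs) with rfl | rfl
      exacts [.refl _ _, hss, hss.symm, .refl _ _]
    by_cases ht : b u = t
    · rcases hAt u hu ht with rfl | rfl <;> rcases hAt v hv (huv.symm.trans ht) with rfl | rfl
      exacts [.refl _ _, htt, htt.symm, .refl _ _]
    rw [hAo u hu hs ht, hAo v hv (huv ▸ hs) (huv ▸ ht), huv]
  · have h3 : swap t₁ t₂ * (swap s₁ s₂ * 1) * (swap s₁ s₂ * τ) = swap t₁ t₂ * τ := by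
      rw [mul_one, mul_assoc, ← mul_assoc (swap s₁ s₂), swap_mul_self, one_mul]
    rw [h3]
    exact forall_sameCycle_swap_mul hn hcov
  · intro z
    by_cases hs : b z = s
    · exact ⟨s₁, hm.1, hs₁.trans hs.symm⟩
    by_cases ht : b z = t
    · exact ⟨t₁, hm.2.2.1, ht₁.trans ht.symm⟩
    exact ⟨r (b z), hmr _ hs ht, hr _⟩
  · intro v
    have hsplit : (Finset.univ.filter fun z => b z = v).card =
        (A.filter fun z => b z = v).card + (Aᶜ.filter fun z => b z = v).card := by
      rw [← Finset.card_union_of_disjoint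
        (Finset.disjoint_filter_filter disjoint_compl_right), ← Finset.filter_union,
        Finset.union_compl]
    have hv := hodd v
    rw [hsplit, Nat.even_add] at hv
    by_cases hs : v = s
    · have : A.filter (fun z => b z = v) = {s₁, s₂} := by
        ext z
        simp only [Finset.mem_filter, Finset.mem_insert, Finset.mem_singleton, hs]
        refine ⟨fun h => hAs z h.1 h.2, ?_⟩
        rintro (rfl | rfl)
        exacts [⟨hm.1, hs₁⟩, ⟨hm.2.1, hs₂⟩]
      rw [this, Finset.card_pair hs12] at hv
      exact (hv.2 (.inl hs)).1 (by decide)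
    by_cases ht : v = t
    · have : A.filter (fun z => b z = v) = {t₁, t₂} := by
        ext z
        simp only [Finset.mem_filter, Finset.mem_insert, Finset.mem_singleton, ht]
        refine ⟨fun h => hAt z h.1 h.2, ?_⟩
        rintro (rfl | rfl)
        exacts [⟨hm.2.2.1, ht₁⟩, ⟨hm.2.2.2, ht₂⟩]
      rw [this, Finset.card_pair ht12] at hv
      exact (hv.2 (.inr ht)).1 (by decide)
    · have : A.filter (fun z => b z = v) = {r v} := by
        ext z
        simp only [Finset.mem_filter, Finset.mem_singleton]
        constructor
        · rintro ⟨hz, rfl⟩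
          exact hAo z hz hs ht
        · rintro rfl
          exact ⟨hmr _ hs ht, hr _⟩
      rw [this, Finset.card_singleton] at hv
      by_contra he
      have hnv : ¬ (v = s ∨ v = t) := by tauto
      exact hnv (hv.1 (iff_of_false (by decide) he))

end Blocks

/-! ### Circuits as permutations of the arcs -/

section OrbitList

variable {α : Type*}

/-- The cycle of `σ` through `x`, listed from `x`. -/
noncomputable def orbitList (σ : Perm α) (x : α) : List α :=
  (List.range (Function.minimalPeriod σ x)).map fun i => σ^[i] x

theorem nodup_orbitList (σ : Perm α) (x : α) : (orbitList σ x).Nodup :=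
  Cycle.nodup_coe_iff.1 (Function.nodup_periodicOrbit (f := σ) (x := x))

theorem mem_orbitList [Finite α] {σ : Perm α} {x y : α} : y ∈ orbitList σ x ↔ σ.SameCycle x y := by
  have h : y ∈ orbitList σ x ↔ ∃ n, σ^[n] x = y :=
    Function.mem_periodicOrbit_iff (f := σ) (σ.injective.mem_periodicPts x)
  rw [h]
  constructor
  · rintro ⟨n, rfl⟩
    exact ⟨n, by rw [zpow_natCast, ← Perm.iterate_eq_pow]⟩
  · intro h
    obtain ⟨n, hn⟩ := h.exists_nat_pow_eq
    exact ⟨n, by rw [Perm.iterate_eq_pow, hn]⟩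

end OrbitList

namespace HalfEdgeGraph

variable {V H : Type*} {G : HalfEdgeGraph V H}

theorem mate_injective (G : HalfEdgeGraph V H) : Function.Injective G.mate :=
  Function.LeftInverse.injective G.mate_mate

theorem IsWalk.append {u v w : V} {l l' : List H} (h : G.IsWalk u l v) (h' : G.IsWalk v l' w) :
    G.IsWalk u (l ++ l') w := by
  induction l generalizing u with
  | nil => cases h; exact h'
  | cons g l ih => exact ⟨h.1, ih h.2⟩

theorem isWalk_map_range {X : Type*} {f : X → X} {p : X → H}
    (hf : ∀ x, G.inc (p (f x)) = G.inc (G.mate (p x))) (n : ℕ) (x : X) :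
    G.IsWalk (G.inc (p x)) ((List.range n).map fun i => p (f^[i] x)) (G.inc (p (f^[n] x))) := by
  induction n generalizing x with
  | zero => rfl
  | succ n ih =>
    rw [List.range_succ_eq_map, List.map_cons, List.map_map]
    refine ⟨rfl, ?_⟩
    have h := ih (f x)
    rw [hf] at h
    exact h

theorem IsWalk.inc_getElem_succ {u v : V} {l : List H} (h : G.IsWalk u l v) {i : ℕ}
    (hi : i + 1 < l.length) : G.inc l[i + 1] = G.inc (G.mate l[i]) := by
  induction l generalizing u i with
  | nil => simp at hi
  | cons g l ih =>
    cases i with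
    | zero =>
      cases l with
      | nil => simp at hi
      | cons g' l => exact h.2.1
    | succ i => exact ih h.2 (by simpa using hi)

theorem IsWalk.inc_getElem_zero {u v : V} {l : List H} (h : G.IsWalk u l v)
    (hl : 0 < l.length) : G.inc l[0] = u := by
  cases l with
  | nil => simp at hl
  | cons g l => exact h.1

theorem IsWalk.inc_mate_getElem_last {u v : V} {l : List H} (h : G.IsWalk u l v) {i : ℕ}
    (hi : i + 1 = l.length) : G.inc (G.mate (l[i]'(by omega))) = v := by
  induction l generalizing u i with
  | nil => simp at hi
  | cons g l ih =>
    cases i with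
    | zero =>
      obtain rfl : l = [] := by simpa using hi
      exact h.2
    | succ i => exact ih h.2 (by simpa using hi)

end HalfEdgeGraph

namespace HalfArcDigraph

variable {V H : Type*} (D : HalfArcDigraph V H)

/-- The arcs, each represented by its outgoing half-arc. -/
abbrev Arc : Type _ := {h : H // D.IsOut h}

/-- The tail of an arc. -/
def tail (e : D.Arc) : V := D.inc e

/-- The head of an arc. -/
def head (e : D.Arc) : V := D.inc (D.mate e)

variable {D}

theorem isOut_mate_of_not {h : H} (hh : ¬ D.IsOut h) : D.IsOut (D.mate h) := (D.isOut_mate h).2 hh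

theorem not_isOut_mate {h : H} (hh : D.IsOut h) : ¬ D.IsOut (D.mate h) :=
  fun h' => (D.isOut_mate h).1 h' hh

theorem IsDirEulerCircuit.mem_iff {u : V} {l : List H} (h : D.IsDirEulerCircuit u l) {g : H} :
    g ∈ l ↔ D.IsOut g := by
  refine ⟨h.2 g, fun hg => ?_⟩
  rcases h.1.2.2.1 g with h1 | h1
  · exact h1.1
  · exact absurd (h.2 _ h1.1) (not_isOut_mate hg)

theorem isDirEulerCircuit_of_mem_iff (hV : ∀ v, ∃ e, D.tail e = v) {u : V} {l : List H}
    (hw : D.IsWalk u l u) (hnd : l.Nodup) (hmem : ∀ g, g ∈ l ↔ D.IsOut g) :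
    D.IsDirEulerCircuit u l := by
  refine ⟨⟨hw, hnd, fun h => ?_, fun v => .inr ?_⟩, fun g => (hmem g).1⟩
  · rw [hmem, hmem, D.isOut_mate]
    by_cases h : D.IsOut h
    · exact .inl ⟨h, not_not.2 h⟩
    · exact .inr ⟨h, h⟩
  · obtain ⟨e, he⟩ := hV v
    exact ⟨e, (hmem e).2 e.2, he⟩

theorem IsDirEulerian.exists_tail_eq (hD : D.IsDirEulerian) {s t : V} (hst : s ≠ t) (v : V) :
    ∃ e, D.tail e = v := by
  obtain ⟨u, l, h⟩ := hD
  have key : ∀ v, v ≠ u → ∃ e, D.tail e = v := fun v hv => by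
    obtain ⟨g, hg, hgv⟩ := (h.1.2.2.2 v).resolve_left hv
    exact ⟨⟨g, h.2 g hg⟩, hgv⟩
  by_cases hv : v = u
  · -- the circuit has an arc since there is a second vertex, and the first arc leaves `u`
    obtain ⟨w, hw⟩ : ∃ w, w ≠ u := by
      by_cases hs : s = u
      · exact ⟨t, fun ht => hst (hs.trans ht.symm)⟩
      · exact ⟨s, hs⟩
    obtain ⟨e, -⟩ := key w hw
    have hl : 0 < l.length := List.length_pos_of_mem (h.mem_iff.2 e.2)
    exact ⟨⟨l[0], h.2 _ (List.getElem_mem hl)⟩,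
      (h.1.1.inc_getElem_zero hl).trans hv.symm⟩
  · exact key v hv

/-- A directed euler circuit defines a cyclic permutation of the arcs: every arc is mapped to the
next one. -/
theorem IsDirEulerian.exists_perm (hD : D.IsDirEulerian) :
    ∃ σ : Perm D.Arc, (∀ e, D.tail (σ e) = D.head e) ∧ ∀ x y, σ.SameCycle x y := by
  classical
  obtain ⟨u, l, h⟩ := hD
  set l' : List D.Arc := l.attachWith D.IsOut h.2 with hl'
  have hlen : l'.length = l.length := by simp [hl']
  have hval : ∀ (i : ℕ) (hi : i < l'.length), (l'[i] : H) = l[i]'(by omega) := by simp [hl']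
  have hnd : l'.Nodup := by
    have : (l'.map Subtype.val).Nodup := by simpa [hl'] using h.1.2.1
    exact this.of_map _
  have hmem : ∀ e, e ∈ l' := fun e => by simp [hl', h.mem_iff, e.2]
  refine ⟨l'.formPerm, fun e => ?_, fun x y => (hnd.isCycleOn_formPerm).2 (hmem x) (hmem y)⟩
  obtain ⟨i, hi, rfl⟩ := List.getElem_of_mem (hmem e)
  rw [List.formPerm_apply_getElem _ hnd]
  unfold tail head
  rw [hval, hval]
  by_cases hi' : i + 1 < l'.length
  · simp only [Nat.mod_eq_of_lt hi']
    exact h.1.1.inc_getElem_succ (by omega)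
  · have h1 : i + 1 = l'.length := by omega
    simp only [h1, Nat.mod_self]
    rw [h.1.1.inc_getElem_zero (by omega), h.1.1.inc_mate_getElem_last (by omega)]

theorem ncard_setOf_tail_eq_head {σ : Perm D.Arc} (hσ : ∀ e, D.tail (σ e) = D.head e)
    (P : V → Prop) : {e | P (D.head e)}.ncard = {e | P (D.tail e)}.ncard := by
  rw [← Set.ncard_image_of_injective _ σ.injective]
  congr 1
  ext e
  simp only [Set.mem_image, Set.mem_ofPred_eq]
  constructor
  · rintro ⟨e, he, rfl⟩
    rwa [hσ]
  · intro he
    exact ⟨σ.symm e, by rwa [← hσ, apply_symm_apply], apply_symm_apply _ _⟩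

theorem isWalk_orbitList {τ : Perm D.Arc} (hτ : ∀ e, D.tail (τ e) = D.head e) (x : D.Arc) :
    D.IsWalk (D.tail x) ((orbitList τ x).map Subtype.val) (D.tail x) := by
  have h := HalfEdgeGraph.isWalk_map_range (G := D.toHalfEdgeGraph) (f := τ) (p := Subtype.val) hτ
    (Function.minimalPeriod τ x) x
  rw [Function.iterate_minimalPeriod] at h
  rw [orbitList, List.map_map]
  exact h

variable [Finite H]

theorem isDirEulerCircuit_orbitList (hV : ∀ v, ∃ e, D.tail e = v) {σ : Perm D.Arc}
    (hσ : ∀ e, D.tail (σ e) = D.head e) (hcyc : ∀ x y, σ.SameCycle x y) (x : D.Arc) :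
    D.IsDirEulerCircuit (D.tail x) ((orbitList σ x).map Subtype.val) := by
  refine isDirEulerCircuit_of_mem_iff hV (isWalk_orbitList hσ x)
    ((nodup_orbitList σ x).map Subtype.val_injective) fun g => ?_
  simp [mem_orbitList, hcyc]

/-- In a balanced digraph, half of the arcs of a cut leave it. -/
theorem two_le_ncard_of_cutsAtLeast {σ : Perm D.Arc} (hσ : ∀ e, D.tail (σ e) = D.head e) {s t : V}
    (hcut : D.CutsAtLeast s t 4) (P : V → Prop) (hs : P s) (ht : ¬ P t) :
    2 ≤ {e | P (D.tail e) ∧ ¬ P (D.head e)}.ncard := by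
  have h1 : D.cut {v | P v} ⊆ (Subtype.val : D.Arc → H) '' {e | P (D.tail e) ∧ ¬ P (D.head e)} ∪
      (fun e : D.Arc => D.mate e) '' {e | P (D.head e) ∧ ¬ P (D.tail e)} := by
    intro h hh
    by_cases ho : D.IsOut h
    · exact .inl ⟨⟨h, ho⟩, hh, rfl⟩
    · refine .inr ⟨⟨D.mate h, isOut_mate_of_not ho⟩, ?_, D.mate_mate h⟩
      have hh : P (D.inc h) ∧ ¬ P (D.inc (D.mate h)) := hh
      simpa [head, tail, D.mate_mate] using hh
  have h2 : {e | P (D.tail e) ∧ ¬ P (D.head e)}.ncard =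
      {e | P (D.head e) ∧ ¬ P (D.tail e)}.ncard := by
    have h3 := Set.ncard_inter_add_ncard_sdiff_eq_ncard {e | P (D.tail e)} {e | P (D.head e)}
    have h4 := Set.ncard_inter_add_ncard_sdiff_eq_ncard {e | P (D.head e)} {e | P (D.tail e)}
    have h5 := ncard_setOf_tail_eq_head hσ P
    rw [Set.inter_comm] at h4
    have h6 : {e | P (D.tail e) ∧ ¬ P (D.head e)} = {e | P (D.tail e)} \ {e | P (D.head e)} := rfl
    have h7 : {e | P (D.head e) ∧ ¬ P (D.tail e)} = {e | P (D.head e)} \ {e | P (D.tail e)} := rfl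
    rw [h6, h7]
    omega
  have h3 := (hcut {v | P v} hs ht).trans ((Set.ncard_le_ncard h1).trans (Set.ncard_union_le _ _))
  rw [Set.ncard_image_of_injective _ Subtype.val_injective,
    Set.ncard_image_of_injective (f := fun e : D.Arc => D.mate e) _
      (D.mate_injective.comp Subtype.val_injective), h2] at h3
  omega

theorem degree_eq {σ : Perm D.Arc} (hσ : ∀ e, D.tail (σ e) = D.head e) (v : V) :
    D.degree v = 2 * {e | D.tail e = v}.ncard := by
  have h1 : {h | D.inc h = v} = Subtype.val '' {e | D.tail e = v} ∪
      (fun e : D.Arc => D.mate e) '' {e | D.head e = v} := by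
    ext h
    constructor
    · intro hh
      by_cases ho : D.IsOut h
      · exact .inl ⟨⟨h, ho⟩, hh, rfl⟩
      · refine .inr ⟨⟨D.mate h, isOut_mate_of_not ho⟩, ?_, D.mate_mate h⟩
        simpa [head, D.mate_mate] using hh
    · rintro (⟨e, he, rfl⟩ | ⟨e, he, rfl⟩) <;> exact he
  have h2 : Disjoint (Subtype.val '' {e | D.tail e = v})
      ((fun e : D.Arc => D.mate e) '' {e | D.head e = v}) := by
    rw [Set.disjoint_left]
    rintro _ ⟨e, -, rfl⟩ ⟨e', -, he'⟩
    have he' : D.mate e' = e := he'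
    exact not_isOut_mate e'.2 (he' ▸ e.2)
  rw [HalfEdgeGraph.degree, h1, Set.ncard_union_eq h2,
    Set.ncard_image_of_injective _ Subtype.val_injective,
    Set.ncard_image_of_injective (f := fun e : D.Arc => D.mate e) _
      (D.mate_injective.comp Subtype.val_injective),
    ncard_setOf_tail_eq_head hσ (· = v), two_mul]

theorem IsDirEulerian.exists_two_cycles [Finite V] (hD : D.IsDirEulerian) {s t : V} (hst : s ≠ t)
    (hcut : D.CutsAtLeast s t 4) :
    ∃ (τ : Perm D.Arc) (s₁ s₂ t₁ t₂ : D.Arc), (∀ e, D.tail (τ e) = D.head e) ∧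
      D.tail s₁ = s ∧ D.tail s₂ = s ∧ D.tail t₁ = t ∧ D.tail t₂ = t ∧
      τ.SameCycle s₁ t₁ ∧ τ.SameCycle s₂ t₂ ∧ ¬ τ.SameCycle t₁ t₂ ∧
      ∀ x, τ.SameCycle t₁ x ∨ τ.SameCycle t₂ x := by
  classical
  have := Fintype.ofFinite V
  have := Fintype.ofFinite D.Arc
  obtain ⟨σ, hσ, hcyc⟩ := hD.exists_perm
  exact _root_.exists_two_cycles hσ hcyc hst (two_le_ncard_of_cutsAtLeast hσ hcut)

theorem pair_sublist_map_orbitList {τ : Perm D.Arc} {x y : D.Arc} (h : τ.SameCycle x y)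
    (hxy : D.tail x ≠ D.tail y) :
    [D.tail x, D.tail y].Sublist (((orbitList τ x).map Subtype.val).map D.inc) := by
  have h0 : 0 < Function.minimalPeriod τ x :=
    Function.minimalPeriod_pos_of_mem_periodicPts (τ.injective.mem_periodicPts x)
  obtain ⟨m, hm⟩ : ∃ m, Function.minimalPeriod τ x = m + 1 := ⟨_, (Nat.sub_add_cancel h0).symm⟩
  obtain ⟨l, hl⟩ : ∃ l, orbitList τ x = x :: l := by
    rw [orbitList, hm, List.range_succ_eq_map]
    exact ⟨_, rfl⟩
  have hy : y ∈ l := by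
    have := mem_orbitList.2 h
    rw [hl, List.mem_cons] at this
    exact this.resolve_left (by rintro rfl; exact hxy rfl)
  rw [hl, List.map_cons, List.map_cons]
  exact .cons_cons _ (List.singleton_sublist.2
    (List.mem_map.2 ⟨_, List.mem_map.2 ⟨y, hy, rfl⟩, rfl⟩))

theorem IsDirEulerian.exists_interlaces [Finite V] (hD : D.IsDirEulerian) {s t : V} (hst : s ≠ t)
    (hcut : D.CutsAtLeast s t 4) : ∃ u l, D.IsDirEulerCircuit u l ∧ D.Interlaces l s t := by
  obtain ⟨τ, s₁, s₂, t₁, t₂, hτ, hs₁, hs₂, ht₁, ht₂, h1, h2, hn, hcov⟩ :=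
    hD.exists_two_cycles hst hcut
  have hw₁ := isWalk_orbitList hτ s₁
  have hw₂ := isWalk_orbitList hτ s₂
  rw [hs₁] at hw₁
  rw [hs₂] at hw₂
  refine ⟨s, (orbitList τ s₁).map Subtype.val ++ (orbitList τ s₂).map Subtype.val,
    isDirEulerCircuit_of_mem_iff (hD.exists_tail_eq hst) (hw₁.append hw₂) ?_ fun g => ?_,
    _, .refl _, ?_⟩
  · rw [← List.map_append]
    refine List.Nodup.map Subtype.val_injective ((nodup_orbitList _ _).append
      (nodup_orbitList _ _) ?_)
    intro e he he'
    exact hn ((h1.symm.trans (mem_orbitList.1 he)).trans ((mem_orbitList.1 he').symm.trans h2))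
  · rw [← List.map_append, List.mem_map]
    constructor
    · rintro ⟨e, -, rfl⟩
      exact e.2
    · intro hg
      refine ⟨⟨g, hg⟩, List.mem_append.2 ((hcov ⟨g, hg⟩).imp ?_ ?_), rfl⟩
      · exact fun h => mem_orbitList.2 (h1.trans h)
      · exact fun h => mem_orbitList.2 (h2.trans h)
  · rw [List.map_append]
    have hp := (pair_sublist_map_orbitList h1 (by rw [hs₁, ht₁]; exact hst)).append
      (pair_sublist_map_orbitList h2 (by rw [hs₂, ht₂]; exact hst))
    rw [hs₁, hs₂, ht₁, ht₂] at hp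
    exact hp

end HalfArcDigraph

/-! ### The embedding with two prescribed facial circuits -/

namespace HalfEdgeGraph.Embedding

variable {V H : Type*} {G : HalfEdgeGraph V H} (Φ : G.Embedding)

theorem inc_rot_zpow (n : ℤ) (h : H) : G.inc ((Φ.rot ^ n) h) = G.inc h :=
  ((Φ.sameCycle_rot _ _).1 ⟨n, rfl⟩).symm

theorem face_iterate (x : H × ℤˣ) (n : ℕ) : Φ.face (Φ.faceStep^[n] x) = Φ.face x := by
  induction n with
  | zero => rfl
  | succ n ih =>
    rw [Function.iterate_succ_apply', ← ih]
    exact (Quot.sound (.inl rfl)).symm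

theorem face_flagRev (x : H × ℤˣ) : Φ.face (Φ.flagRev x) = Φ.face x :=
  (Quot.sound (.inr rfl)).symm

theorem faceStep_injective : Function.Injective Φ.faceStep := by
  rintro ⟨h, ε⟩ ⟨h', ε'⟩ heq
  obtain ⟨h1, h2⟩ := Prod.mk.inj heq
  simp only at h1 h2
  rw [h2] at h1
  obtain rfl := G.mate_injective ((Φ.rot ^ _).injective h1)
  rw [mul_right_cancel h2]

end HalfEdgeGraph.Embedding

namespace HalfArcDigraph

variable {V H : Type*} {D : HalfArcDigraph V H}

open Classical in
/-- The rotation of the embedding whose facial circuits are `σ` and `σ'`: an incoming half-arc is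
followed by the arc that succeeds it in `σ`, and an outgoing half-arc is followed by the arc that
precedes it in `σ'`. -/
noncomputable def rotOfPerms (σ σ' : Perm D.Arc) : Perm H where
  toFun h := if hh : D.IsOut h then D.mate (σ'.symm ⟨h, hh⟩)
    else σ ⟨D.mate h, isOut_mate_of_not hh⟩
  invFun h := if hh : D.IsOut h then D.mate (σ.symm ⟨h, hh⟩)
    else σ' ⟨D.mate h, isOut_mate_of_not hh⟩
  left_inv h := by
    by_cases hh : D.IsOut h
    · simp [hh, not_isOut_mate (σ'.symm ⟨h, hh⟩).2, D.mate_mate]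
    · simp [hh, (σ ⟨D.mate h, isOut_mate_of_not hh⟩).2, D.mate_mate]
  right_inv h := by
    by_cases hh : D.IsOut h
    · simp [hh, not_isOut_mate (σ.symm ⟨h, hh⟩).2, D.mate_mate]
    · simp [hh, (σ' ⟨D.mate h, isOut_mate_of_not hh⟩).2, D.mate_mate]

variable {σ σ' : Perm D.Arc}

theorem rotOfPerms_arc (e : D.Arc) : rotOfPerms σ σ' e = D.mate (σ'.symm e) := by
  simp [rotOfPerms, e.2]

theorem rotOfPerms_mate (e : D.Arc) : rotOfPerms σ σ' (D.mate e) = σ e := by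
  simp [rotOfPerms, not_isOut_mate e.2, D.mate_mate]

theorem rotOfPerms_symm_mate (e : D.Arc) : (rotOfPerms σ σ').symm (D.mate e) = σ' e := by
  rw [symm_apply_eq, rotOfPerms_arc, symm_apply_apply]

theorem rotOfPerms_symm_arc (e : D.Arc) : (rotOfPerms σ σ').symm e = D.mate (σ.symm e) := by
  rw [symm_apply_eq, rotOfPerms_mate, apply_symm_apply]

theorem eq_arc_or_eq_mate (h : H) : (∃ e : D.Arc, h = e) ∨ ∃ e : D.Arc, h = D.mate e := by
  by_cases hh : D.IsOut h
  · exact .inl ⟨⟨h, hh⟩, rfl⟩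
  · exact .inr ⟨⟨_, isOut_mate_of_not hh⟩, (D.mate_mate h).symm⟩

variable [Finite H] {π : Perm D.Arc}

theorem sameCycle_rotOfPerms (hσ : ∀ e, D.tail (σ e) = D.head e)
    (hπ : ∀ e, D.tail (π e) = D.tail e) (hπ' : ∀ e f, D.tail e = D.tail f → π.SameCycle e f)
    (h k : H) : (rotOfPerms σ (π * σ)).SameCycle h k ↔ D.inc h = D.inc k := by
  have hsymm : ∀ e, D.head ((π * σ).symm e) = D.tail e := fun e => by
    rw [← hσ, ← hπ, ← Perm.mul_apply, apply_symm_apply]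
  constructor
  · intro h1
    refine rel_of_sameCycle (ρ := rotOfPerms σ (π * σ)) (R := fun h k => D.inc h = D.inc k)
      (fun _ => rfl) (fun _ _ _ => Eq.trans) (fun u => ?_) h1
    rcases eq_arc_or_eq_mate (D := D) u with ⟨e, rfl⟩ | ⟨e, rfl⟩
    · rw [rotOfPerms_arc]
      exact (hsymm e).symm
    · rw [rotOfPerms_mate]
      exact (hσ e).symm
  · -- two steps of the rotation map an arc `π e` to `e`
    have hstep : ∀ e : D.Arc, (rotOfPerms σ (π * σ)).SameCycle (π e : D.Arc) e := fun e =>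
      ⟨2, by
        rw [zpow_ofNat, pow_two, Perm.mul_apply, rotOfPerms_arc, rotOfPerms_mate]
        have h1 : (π * σ).symm (π e) = σ.symm e := by
          rw [symm_apply_eq, Perm.mul_apply, apply_symm_apply]
        rw [h1, apply_symm_apply]⟩
    have key : ∀ e f : D.Arc, D.tail e = D.tail f →
        (rotOfPerms σ (π * σ)).SameCycle (e : H) f := fun e f hef =>
      rel_of_sameCycle (R := fun e f : D.Arc => (rotOfPerms σ (π * σ)).SameCycle (e : H) f)
        (fun _ => .refl _ _) (fun _ _ _ => .trans) (fun u => (hstep u).symm) (hπ' e f hef)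
    have hout : ∀ h : H, ∃ e : D.Arc, (rotOfPerms σ (π * σ)).SameCycle h e ∧
        D.inc h = D.tail e := by
      intro h
      rcases eq_arc_or_eq_mate (D := D) h with ⟨e, rfl⟩ | ⟨e, rfl⟩
      · exact ⟨e, .refl _ _, rfl⟩
      · refine ⟨σ e, ?_, (hσ e).symm⟩
        rw [← rotOfPerms_mate (σ' := π * σ), Perm.sameCycle_apply_right]
    intro hhk
    obtain ⟨e, he, he'⟩ := hout h
    obtain ⟨f, hf, hf'⟩ := hout k
    exact (he.trans (key e f (by rw [← he', ← hf', hhk]))).trans hf.symm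

/-- The embedding with facial circuits `σ` and `π * σ`, where the cycles of `π` are the sets of
arcs with a common tail. All edges are positive. -/
noncomputable def embeddingOfPerms (hσ : ∀ e, D.tail (σ e) = D.head e)
    (hπ : ∀ e, D.tail (π e) = D.tail e) (hπ' : ∀ e f, D.tail e = D.tail f → π.SameCycle e f) :
    D.toHalfEdgeGraph.Embedding where
  rot := rotOfPerms σ (π * σ)
  sameCycle_rot := sameCycle_rotOfPerms hσ hπ hπ'
  sgn _ := 1
  sgn_mate _ := rfl

/-- A facial walk along which face tracing is given by a cyclic permutation of the arcs is a
directed euler circuit. -/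
theorem isDirEulerCircuit_facialWalk (hV : ∀ v, ∃ e, D.tail e = v)
    (Φ : D.toHalfEdgeGraph.Embedding) {ε : ℤˣ}
    (hstep : ∀ e : D.Arc, Φ.faceStep ((e : H), ε) = (((σ e : D.Arc) : H), ε))
    (hσ : ∀ e, D.tail (σ e) = D.head e) (hcyc : ∀ x y, σ.SameCycle x y) (e : D.Arc) :
    D.IsDirEulerCircuit (D.inc e) (Φ.facialWalk ((e : H), ε)) := by
  have hit : ∀ n, Φ.faceStep^[n] ((e : H), ε) = (((σ^[n] e : D.Arc) : H), ε) := fun n => by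
    induction n with
    | zero => rfl
    | succ n ih => rw [Function.iterate_succ_apply', ih, hstep, Function.iterate_succ_apply']
  have hper : Function.minimalPeriod Φ.faceStep ((e : H), ε) = Function.minimalPeriod σ e := by
    rw [Function.minimalPeriod_eq_minimalPeriod_iff]
    intro n
    rw [Function.IsPeriodicPt, Function.IsFixedPt, hit, Function.IsPeriodicPt, Function.IsFixedPt]
    simp [Prod.ext_iff, Subtype.ext_iff]
  have hwalk : Φ.facialWalk ((e : H), ε) = (orbitList σ e).map Subtype.val := by
    rw [HalfEdgeGraph.Embedding.facialWalk, hper, orbitList, List.map_map]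
    exact List.map_congr_left fun i _ => by rw [hit]; rfl
  rw [hwalk]
  exact isDirEulerCircuit_orbitList hV hσ hcyc e

/-- The face on the positive side of the arcs is traced by `σ`, the one on their negative side by
`π * σ`. -/
theorem exists_embedding_of_perms (hV : ∀ v, ∃ e, D.tail e = v) [Nonempty D.Arc]
    (hσ : ∀ e, D.tail (σ e) = D.head e) (hcyc : ∀ x y, σ.SameCycle x y)
    (hπ : ∀ e, D.tail (π e) = D.tail e) (hπ' : ∀ e f, D.tail e = D.tail f → π.SameCycle e f)
    (hcyc' : ∀ x y, (π * σ).SameCycle x y) :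
    ∃ Φ : D.toHalfEdgeGraph.Embedding,
      D.IsDirectedEmbedding Φ ∧ D.IsDirBiEulerian Φ ∧ Φ.IsOrientable := by
  classical
  obtain ⟨e₀⟩ := ‹Nonempty D.Arc›
  set Φ := embeddingOfPerms hσ hπ hπ' with hΦ
  have hpos : ∀ h, Φ.faceStep (h, 1) = (rotOfPerms σ (π * σ) (D.mate h), 1) := fun h => by
    simp [HalfEdgeGraph.Embedding.faceStep, hΦ, embeddingOfPerms]
  have hneg : ∀ h, Φ.faceStep (h, -1) = ((rotOfPerms σ (π * σ)).symm (D.mate h), -1) := fun h => by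
    simp [HalfEdgeGraph.Embedding.faceStep, hΦ, embeddingOfPerms]
  have hrev : ∀ h ε, Φ.flagRev (h, ε) = (D.mate h, -ε) := fun h ε => by
    simp [HalfEdgeGraph.Embedding.flagRev, hΦ, embeddingOfPerms]
  have hpos' : ∀ e : D.Arc, Φ.faceStep ((e : H), 1) = (((σ e : D.Arc) : H), 1) := fun e => by
    rw [hpos, rotOfPerms_mate]
  have hneg' : ∀ e : D.Arc, Φ.faceStep ((e : H), -1) = ((((π * σ) e : D.Arc) : H), -1) := fun e => by
    rw [hneg, rotOfPerms_symm_mate]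
  have hσ' : ∀ e, D.tail ((π * σ) e) = D.head e := fun e => by rw [Perm.mul_apply, hπ, hσ]
  -- the side of an arc on which a flag lies, read in the direction of the arc
  set side : H × ℤˣ → ℤˣ := fun x => if D.IsOut x.1 then x.2 else -x.2 with hside
  have hside_rev : ∀ x, side (Φ.flagRev x) = side x := by
    rintro ⟨h, ε⟩
    rw [hrev]
    by_cases hh : D.IsOut h <;> simp [hside, hh, D.isOut_mate]
  have hside_step : ∀ x, side (Φ.faceStep x) = side x := by
    rintro ⟨h, ε⟩
    rcases Int.units_eq_one_or ε with rfl | rfl <;>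
      rcases eq_arc_or_eq_mate (D := D) h with ⟨e, rfl⟩ | ⟨e, rfl⟩
    · rw [hpos']
      simp [hside, e.2, (σ e).2]
    · rw [hpos, D.mate_mate, rotOfPerms_arc]
      simp [hside, not_isOut_mate e.2, not_isOut_mate ((π * σ).symm e).2]
    · rw [hneg']
      simp only [hside, e.2, ((π * σ) e).2, if_true]
    · rw [hneg, D.mate_mate, rotOfPerms_symm_arc]
      simp [hside, not_isOut_mate e.2, not_isOut_mate (σ.symm e).2]
  have hne : Φ.face ((e₀ : H), 1) ≠ Φ.face ((e₀ : H), -1) := by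
    intro h
    have := congrArg (Quot.lift side (by
      rintro x y (rfl | rfl)
      · exact (hside_step x).symm
      · exact (hside_rev x).symm)) h
    simp [HalfEdgeGraph.Embedding.face, hside, e₀.2] at this
  have hsame : ∀ {ρ : Perm D.Arc} {ε : ℤˣ},
      (∀ e : D.Arc, Φ.faceStep ((e : H), ε) = (((ρ e : D.Arc) : H), ε)) → (∀ x y, ρ.SameCycle x y) →
      ∀ e : D.Arc, Φ.face ((e : H), ε) = Φ.face ((e₀ : H), ε) := fun {ρ ε} h1 h2 e =>
    rel_of_sameCycle (R := fun e f : D.Arc => Φ.face ((e : H), ε) = Φ.face ((f : H), ε))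
      (fun _ => rfl) (fun _ _ _ => Eq.trans)
      (fun u => by rw [← h1]; exact (Φ.face_iterate _ 1).symm) (h2 e e₀)
  have hcases : ∀ f : Φ.Face, f = Φ.face ((e₀ : H), 1) ∨ f = Φ.face ((e₀ : H), -1) := by
    rintro ⟨h, ε⟩
    have hout : ∀ (e : D.Arc) (ε : ℤˣ), Φ.face ((e : H), ε) = Φ.face ((e₀ : H), 1) ∨
        Φ.face ((e : H), ε) = Φ.face ((e₀ : H), -1) := fun e ε => by
      rcases Int.units_eq_one_or ε with rfl | rfl
      · exact .inl (hsame hpos' hcyc e)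
      · exact .inr (hsame hneg' hcyc' e)
    rcases eq_arc_or_eq_mate (D := D) h with ⟨e, rfl⟩ | ⟨e, rfl⟩
    · exact hout e ε
    · have := hout e (-ε)
      rwa [← Φ.face_flagRev, hrev, neg_neg] at this
  have hcirc : ∀ f : Φ.Face, ∃ x, Φ.face x = f ∧
      D.IsDirEulerCircuit (D.inc x.1) (Φ.facialWalk x) := fun f => by
    rcases hcases f with rfl | rfl
    · exact ⟨_, rfl, isDirEulerCircuit_facialWalk hV Φ hpos' hσ hcyc e₀⟩
    · exact ⟨_, rfl, isDirEulerCircuit_facialWalk hV Φ hneg' hσ' hcyc' e₀⟩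
  refine ⟨Φ, fun f => ?_, ⟨?_, hcirc⟩, 1, fun h => rfl⟩
  · obtain ⟨x, hx, hx'⟩ := hcirc f
    exact ⟨x, hx, hx'.2⟩
  · refine Nat.card_eq_two_iff.2 ⟨_, _, hne, Set.eq_univ_of_forall fun f => ?_⟩
    simpa using hcases f

theorem IsDirEulerian.exists_orientable_embedding [Finite V] (hD : D.IsDirEulerian) {s t : V}
    (hst : s ≠ t) (hdeg : ∀ v, 4 ∣ D.degree v ↔ v = s ∨ v = t) (hcut : D.CutsAtLeast s t 4) :
    ∃ Φ : D.toHalfEdgeGraph.Embedding,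
      D.IsDirectedEmbedding Φ ∧ D.IsDirBiEulerian Φ ∧ Φ.IsOrientable := by
  classical
  have := Fintype.ofFinite D.Arc
  obtain ⟨τ, s₁, s₂, t₁, t₂, hτ, hs₁, hs₂, ht₁, ht₂, h1, h2, hn, hcov⟩ :=
    hD.exists_two_cycles hst hcut
  have hV := hD.exists_tail_eq hst
  obtain ⟨hcyc, π, hπ, hπ', hcyc'⟩ := exists_blocks_of_two_cycles hst hs₁ hs₂ ht₁ ht₂ h1 h2 hn hcov
    hV fun v => by
      have h3 : (Finset.univ.filter fun z => D.tail z = v).card = {e | D.tail e = v}.ncard := by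
        rw [← Set.ncard_coe_finset]
        simp
      rw [← hdeg, degree_eq hτ, h3, even_iff_two_dvd]
      omega
  have : Nonempty D.Arc := ⟨s₁⟩
  exact exists_embedding_of_perms hV (tail_swap_mul hτ (hs₁.trans hs₂.symm)) hcyc hπ hπ' hcyc'

end HalfArcDigraph

/-! ### Directed bi-eulerian embeddings are orientable -/

namespace HalfEdgeGraph.Embedding

variable {V H : Type*} {G : HalfEdgeGraph V H} (Φ : G.Embedding)

/-- The flags met when tracing a face from the flag `x`. -/
def orbit (x : H × ℤˣ) : Set (H × ℤˣ) := {z | ∃ n, Φ.faceStep^[n] x = z}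

variable {Φ} {x z : H × ℤˣ}

theorem faceStep_mem_orbit (h : z ∈ Φ.orbit x) : Φ.faceStep z ∈ Φ.orbit x := by
  obtain ⟨n, rfl⟩ := h
  exact ⟨n + 1, Function.iterate_succ_apply' _ _ _⟩

theorem face_eq_of_mem_orbit (h : z ∈ Φ.orbit x) : Φ.face z = Φ.face x := by
  obtain ⟨n, rfl⟩ := h
  exact Φ.face_iterate x n

variable [Finite H]

theorem mem_facialWalk {h : H} : h ∈ Φ.facialWalk x ↔ ∃ ε, (h, ε) ∈ Φ.orbit x := by
  have h1 : ∀ z, z ∈ Φ.orbit x ↔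
      z ∈ (List.range (Function.minimalPeriod Φ.faceStep x)).map fun i => Φ.faceStep^[i] x :=
    fun z => (Function.mem_periodicOrbit_iff (Φ.faceStep_injective.mem_periodicPts x)).symm
  simp only [h1, facialWalk, List.mem_map]
  constructor
  · rintro ⟨i, hi, rfl⟩
    exact ⟨_, i, hi, rfl⟩
  · rintro ⟨ε, i, hi, hε⟩
    exact ⟨i, hi, by rw [hε]⟩

theorem mem_orbit_of_faceStep_mem (h : Φ.faceStep z ∈ Φ.orbit x) : z ∈ Φ.orbit x := by
  obtain ⟨n, hn⟩ := h
  obtain ⟨p, hp, hpx⟩ := Φ.faceStep_injective.mem_periodicPts x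
  obtain ⟨q, rfl⟩ : ∃ q, p = q + 1 := ⟨p - 1, by omega⟩
  refine ⟨n + q, Φ.faceStep_injective ?_⟩
  rw [← hn, ← Function.iterate_succ_apply' Φ.faceStep, Nat.succ_eq_add_one, add_assoc,
    Function.iterate_add_apply]
  exact congrArg _ hpx

end HalfEdgeGraph.Embedding

namespace HalfArcDigraph

variable {V H : Type*} [Finite H] {D : HalfArcDigraph V H}

/-- Two directed facial circuits alternate at the corners of every vertex. Hence one of them leaves
a vertex with the same local orientation whenever it passes, and these local orientations orient
the embedding. -/
theorem isOrientable_of_isDirBiEulerian {Φ : D.toHalfEdgeGraph.Embedding}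
    (hΦ : D.IsDirBiEulerian Φ) : Φ.IsOrientable := by
  classical
  obtain ⟨f, g, hfg, -⟩ := Nat.card_eq_two_iff.1 hΦ.1
  obtain ⟨x, rfl, hx⟩ := hΦ.2 f
  obtain ⟨y, rfl, hy⟩ := hΦ.2 g
  have hxo : ∀ {h ε}, (h, ε) ∈ Φ.orbit x → D.IsOut h := fun h1 =>
    hx.2 _ (HalfEdgeGraph.Embedding.mem_facialWalk.2 ⟨_, h1⟩)
  have hyo : ∀ {h ε}, (h, ε) ∈ Φ.orbit y → D.IsOut h := fun h1 =>
    hy.2 _ (HalfEdgeGraph.Embedding.mem_facialWalk.2 ⟨_, h1⟩)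
  have hdisj : ∀ {z}, z ∈ Φ.orbit x → z ∉ Φ.orbit y := fun h1 h2 =>
    hfg ((HalfEdgeGraph.Embedding.face_eq_of_mem_orbit h1).symm.trans
      (HalfEdgeGraph.Embedding.face_eq_of_mem_orbit h2))
  have hxe : ∀ {h}, D.IsOut h → ∃ ε, (h, ε) ∈ Φ.orbit x := fun h1 =>
    HalfEdgeGraph.Embedding.mem_facialWalk.1 (hx.mem_iff.2 h1)
  have hye : ∀ {h}, D.IsOut h → ∃ ε, (h, ε) ∈ Φ.orbit y := fun h1 =>
    HalfEdgeGraph.Embedding.mem_facialWalk.1 (hy.mem_iff.2 h1)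
  -- the two circuits use the two sides of every arc
  have hswap : ∀ {h ε}, (h, ε) ∈ Φ.orbit x → (h, -ε) ∈ Φ.orbit y := by
    intro h ε h1
    obtain ⟨δ, hδ⟩ := hye (hxo h1)
    have hne : δ ≠ ε := by rintro rfl; exact hdisj h1 hδ
    rwa [Int.units_ne_iff_eq_neg.1 hne] at hδ
  have hswap' : ∀ {h ε}, (h, ε) ∈ Φ.orbit y → (h, -ε) ∈ Φ.orbit x := by
    intro h ε h1
    obtain ⟨δ, hδ⟩ := hxe (hyo h1)
    have hne : δ ≠ ε := by rintro rfl; exact hdisj hδ h1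
    rwa [Int.units_ne_iff_eq_neg.1 hne] at hδ
  have huniq : ∀ {h ε δ}, (h, ε) ∈ Φ.orbit x → (h, δ) ∈ Φ.orbit x → ε = δ := by
    intro h ε δ h1 h2
    by_contra hne
    rw [← ne_eq, Int.units_ne_iff_eq_neg] at hne
    exact hdisj h1 (hne ▸ hswap h2)
  have hturn : ∀ {h : H} {ε : ℤˣ}, (h, ε) ∈ Φ.orbit x →
      ¬ D.IsOut ((Φ.rot ^ (ε : ℤ)) h) ∧
        ((Φ.rot ^ (ε : ℤ)) ((Φ.rot ^ (ε : ℤ)) h), ε) ∈ Φ.orbit x := by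
    intro h ε h1
    set k := (Φ.rot ^ (ε : ℤ)) h with hk
    have h2 : Φ.faceStep (D.mate k, -ε * Φ.sgn k) = (h, -ε) := by
      have h3 : -ε * Φ.sgn k * Φ.sgn k = -ε := by rw [mul_assoc, Int.units_mul_self, mul_one]
      simp only [HalfEdgeGraph.Embedding.faceStep, Φ.sgn_mate, h3, D.mate_mate]
      rw [hk, Units.val_neg, zpow_neg, Perm.inv_def, symm_apply_apply]
    have h4 : (D.mate k, -ε * Φ.sgn k) ∈ Φ.orbit y :=
      HalfEdgeGraph.Embedding.mem_orbit_of_faceStep_mem (h2 ▸ hswap h1)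
    refine ⟨fun h5 => not_isOut_mate h5 (hyo h4), ?_⟩
    have h5 := HalfEdgeGraph.Embedding.faceStep_mem_orbit (hswap' h4)
    have h6 : -(-ε * Φ.sgn k) * Φ.sgn k = ε := by
      rw [neg_mul, mul_assoc, Int.units_mul_self, mul_one, neg_neg]
    simpa only [HalfEdgeGraph.Embedding.faceStep, Φ.sgn_mate, h6, D.mate_mate] using h5
  have hvertex : ∀ {h k : H} {ε : ℤˣ}, (h, ε) ∈ Φ.orbit x → D.IsOut k → D.inc h = D.inc k →
      (k, ε) ∈ Φ.orbit x := by
    intro h k ε h1 hk hhk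
    have hc : (Φ.rot ^ (ε : ℤ)).SameCycle h k := by
      have := (Φ.sameCycle_rot h k).2 hhk
      rcases Int.units_eq_one_or ε with rfl | rfl
      · simpa using this
      · simpa using this.inv
    let Q : H → Prop := fun k => (D.IsOut k → (k, ε) ∈ Φ.orbit x) ∧
      (¬ D.IsOut k → ((Φ.rot ^ (ε : ℤ)) k, ε) ∈ Φ.orbit x)
    have hQ : Q h → Q k := by
      refine rel_of_sameCycle (R := fun h k => Q h → Q k) (fun _ => id)
        (fun _ _ _ f g => g ∘ f) (fun u hu => ?_) hc
      by_cases ho : D.IsOut u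
      · obtain ⟨h2, h3⟩ := hturn (hu.1 ho)
        exact ⟨fun h4 => absurd h4 h2, fun _ => h3⟩
      · exact ⟨fun _ => hu.2 ho, fun h4 => absurd (hxo (hu.2 ho)) h4⟩
    exact (hQ ⟨fun _ => h1, fun h2 => absurd (hxo h1) h2⟩).1 hk
  let o : V → ℤˣ := fun v => if ∃ h, D.inc h = v ∧ (h, 1) ∈ Φ.orbit x then 1 else -1
  have ho : ∀ {h ε}, (h, ε) ∈ Φ.orbit x → ε = o (D.inc h) := by
    intro h ε h1
    by_cases h2 : ∃ k, D.inc k = D.inc h ∧ (k, 1) ∈ Φ.orbit x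
    · obtain ⟨k, hk, hk'⟩ := h2
      have h3 : o (D.inc h) = 1 := if_pos ⟨k, hk, hk'⟩
      rw [h3]
      exact huniq h1 (hvertex hk' (hxo h1) hk)
    · have h3 : o (D.inc h) = -1 := if_neg h2
      rw [h3]
      refine (Int.units_eq_one_or ε).resolve_left ?_
      rintro rfl
      exact h2 ⟨h, rfl, h1⟩
  have harc : ∀ h, D.IsOut h → Φ.sgn h = o (D.inc h) * o (D.inc (D.mate h)) := by
    intro h hh
    obtain ⟨ε, hε⟩ := hxe hh
    have h1 := ho (HalfEdgeGraph.Embedding.faceStep_mem_orbit hε)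
    rw [Φ.inc_rot_zpow] at h1
    rw [← h1, ← ho hε, ← mul_assoc, Int.units_mul_self, one_mul]
  refine ⟨o, fun h => ?_⟩
  by_cases hh : D.IsOut h
  · exact harc h hh
  · have := harc _ (isOut_mate_of_not hh)
    rwa [Φ.sgn_mate, D.mate_mate, mul_comm] at this

end HalfArcDigraph

/-! ### Orienting an eulerian graph -/

namespace HalfEdgeGraph

variable {V H : Type*} {G : HalfEdgeGraph V H}

/-- The digraph obtained by orienting every edge in the direction in which an euler circuit
traverses it. -/
def orient (G : HalfEdgeGraph V H) {u : V} {l : List H} (h : G.IsEulerCircuit u l) :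
    HalfArcDigraph V H where
  toHalfEdgeGraph := G
  IsOut g := g ∈ l
  isOut_mate g := by
    rcases h.2.2.1 g with h1 | h1
    · exact iff_of_false h1.2 (not_not.2 h1.1)
    · exact iff_of_true h1.1 h1.2

theorem isDirEulerian_orient {u : V} {l : List H} (h : G.IsEulerCircuit u l) :
    (G.orient h).IsDirEulerian :=
  ⟨u, l, h, fun _ => id⟩

theorem IsEulerian.exists_orientable_embedding [Finite V] [Finite H] (hG : G.IsEulerian) {s t : V}
    (hst : s ≠ t) (hdeg : ∀ v, 4 ∣ G.degree v ↔ v = s ∨ v = t) (hcut : G.CutsAtLeast s t 4) :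
    ∃ Φ : G.Embedding, Φ.IsOrientable ∧ Φ.IsBiEulerian := by
  obtain ⟨u, l, h⟩ := hG
  obtain ⟨Φ, -, h1, h2⟩ :=
    (isDirEulerian_orient h).exists_orientable_embedding hst hdeg hcut
  exact ⟨Φ, h2, h1.1, fun f => (h1.2 f).imp fun x hx => ⟨hx.1, hx.2.1⟩⟩

end HalfEdgeGraph

theorem mainTheorem4 {V H : Type*} [Finite V] [Finite H] :
    -- an euler circuit interlacing two given vertices
    (∀ D : HalfArcDigraph V H, D.IsDirEulerian → ∀ s t : V, s ≠ t →
      D.CutsAtLeast s t 4 →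
      ∃ u l, D.IsDirEulerCircuit u l ∧ D.Interlaces l s t) ∧
    -- digraphs
    (∀ D : HalfArcDigraph V H, D.IsDirEulerian → ∀ s t : V, s ≠ t →
      (∀ v, 4 ∣ D.degree v ↔ v = s ∨ v = t) →
      D.CutsAtLeast s t 4 →
      (∃ Φ : D.toHalfEdgeGraph.Embedding,
        D.IsDirectedEmbedding Φ ∧ D.IsDirBiEulerian Φ ∧ Φ.IsOrientable) ∧
      ∀ Φ : D.toHalfEdgeGraph.Embedding, D.IsDirBiEulerian Φ → Φ.IsOrientable) ∧
    -- undirected graphs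
    (∀ G : HalfEdgeGraph V H, G.IsEulerian → ∀ s t : V, s ≠ t →
      (∀ v, 4 ∣ G.degree v ↔ v = s ∨ v = t) →
      G.CutsAtLeast s t 4 →
      ∃ Φ : G.Embedding, Φ.IsOrientable ∧ Φ.IsBiEulerian) := by
  refine ⟨fun D hD s t hst hcut => hD.exists_interlaces hst hcut,
    fun D hD s t hst hdeg hcut => ⟨hD.exists_orientable_embedding hst hdeg hcut,
      fun Φ hΦ => HalfArcDigraph.isOrientable_of_isDirBiEulerian hΦ⟩,
    fun G hG s t hst hdeg hcut => hG.exists_orientable_embedding hst hdeg hcut⟩
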